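/- Let $N>1$ and $K_I,K_E\ge 1$ be integers. Let $h_1,\dots,h_{K_I}\in\mathbb C^N$ and $g_1,\dots,g_{K_E}\in\mathbb C^N$ be arbitrary channel vectors, let $\sigma>0$, $P_{\rm sum}>0$, $\alpha_i>0$ $(1\le i\le K_I)$ and $E_j>0$ $(1\le j\le K_E)$ be real numbers, and put $G_j=g_jg_j^H$. For positive semidefinite matrices $S_1,\dots,S_{K_I}\in\mathbb C^{N\times N}$ let $$\mathcal C(\{S_i\})=\bigcup_{\pi}\left\{r\in\mathbb R_{\ge 0}^{K_I}:\ r_{\pi(i)}\le\log_2\frac{\sigma^2+h_{\pi(i)}^H\left(\sum_{k=i}^{K_I}S_{\pi(k)}\right)h_{\pi(i)}}{\sigma^2+h_{\pi(i)}^H\left(\sum_{k=i+1}^{K_I}S_{\pi(k)}\right)h_{\pi(i)}}\ \text{ for } 1\le i\le K_I\right\},$$ where $\pi$ runs over all permutations of $\{1,\dots,K_I\}$. (P1) is the problem of maximizing $\sum_i\alpha_ir_i$ over positive semidefinite $S_1,\dots,S_{K_I},S_E\in\mathbb C^{N\times N}$ and $r\in\mathcal C(\{S_i\})$ subject to $$\operatorname{Tr}\Big[\Big(\sum_iS_i+S_E\Big)G_j\Big]\ge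 E_j\quad(1\le j\le K_E),\qquad \operatorname{Tr}\Big(\sum_iS_i+S_E\Big)\le P_{\rm sum}.$$ For real $\lambda_0,\lambda_1,\dots,\lambda_{K_E}\ge 0$ let $A=\lambda_0I-\sum_j\lambda_jG_j$ and $P_A=\lambda_0P_{\rm sum}-\sum_j\lambda_jE_j$, and let $g(\{\lambda_j\})\in[-\infty,+\infty]$ be the supremum of $\sum_i\alpha_ir_i$ over positive semidefinite $S_1,\dots,S_{K_I},S_E\in\mathbb C^{N\times N}$ and $r\in\mathcal C(\{S_i\})$ subject to the single constraint $$\sum_i\operatorname{Tr}(AS_i)+\operatorname{Tr}(AS_E)\le P_A .$$ (P2) is the problem of minimizing $g(\{\lambda_j\})$ over all $\lambda_0,\lambda_1,\dots,\lambda_{K_E}\ge 0$. Assume that (P1) is feasible. Then the optimal value of (P1) (the supremum of its objective) is equal to the optimal value of (P2) (the infimum of $g$). -/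

import Mathlib

open scoped Matrix ComplexOrder

noncomputable section

/-- Data of a MISO broadcast channel for simultaneous wireless information and power transfer:
`N` transmit antennas, `KI` information receivers and `KE` energy receivers. -/
structure SwiptBC (N KI KE : ℕ) where
  /-- channel vector to each information receiver -/
  h : Fin KI → Fin N → ℂ
  /-- channel vector to each energy receiver -/
  g : Fin KE → Fin N → ℂ
  /-- noise standard deviation; the noise power at each information receiver is `σ ^ 2` -/
  σ : ℝ
  /-- rate weights -/
  α : Fin KI → ℝ
  /-- maximum sum-power -/
  Psum : ℝ
  /-- minimum harvested power at each energy receiver -/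
  E : Fin KE → ℝ

namespace SwiptBC

variable {N KI KE : ℕ}

/-- The quadratic form `vᴴ S v`, which is a real number for Hermitian `S`. -/
def quad (S : Matrix (Fin N) (Fin N) ℂ) (v : Fin N → ℂ) : ℝ :=
  (star v ⬝ᵥ (S *ᵥ v)).re

/-- The trace `Tr(A S)` of a product, which is a real number for Hermitian `A` and `S`. -/
def trMul (A S : Matrix (Fin N) (Fin N) ℂ) : ℝ :=
  (A * S).trace.re

/-- `G j = g j (g j)ᴴ`. -/
def G (M : SwiptBC N KI KE) (j : Fin KE) : Matrix (Fin N) (Fin N) ℂ :=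
  Matrix.vecMulVec (M.g j) (star (M.g j))

/-- The dirty-paper-coding bound (bps/Hz) on the rate of the receiver `π i`, which is encoded in
the `i`-th place for the encoding order `π`: the signals encoded later are interference. -/
def dpcRate (M : SwiptBC N KI KE) (S : Fin KI → Matrix (Fin N) (Fin N) ℂ)
    (π : Equiv.Perm (Fin KI)) (i : Fin KI) : ℝ :=
  Real.logb 2
    ((M.σ ^ 2 + quad (∑ k ∈ Finset.Ici i, S (π k)) (M.h (π i))) /
      (M.σ ^ 2 + quad (∑ k ∈ Finset.Ioi i, S (π k)) (M.h (π i))))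

/-- The achievable rate region for given information covariance matrices: the union over all
encoding orders of the nonnegative rate tuples that meet the dirty-paper-coding bounds. -/
def rateRegion (M : SwiptBC N KI KE) (S : Fin KI → Matrix (Fin N) (Fin N) ℂ) :
    Set (Fin KI → ℝ) :=
  ⋃ π : Equiv.Perm (Fin KI), {r | (∀ i, 0 ≤ r i) ∧ ∀ i, r (π i) ≤ M.dpcRate S π i}

/-- The weighted sum-rate. -/
def wsr (M : SwiptBC N KI KE) (r : Fin KI → ℝ) : ℝ :=
  ∑ i, M.α i * r i

/-- The decision variables of both problems: information covariances, rates and energy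
covariance. -/
structure Point (N KI : ℕ) where
  S : Fin KI → Matrix (Fin N) (Fin N) ℂ
  r : Fin KI → ℝ
  SE : Matrix (Fin N) (Fin N) ℂ

/-- The constraints common to both problems: positive semidefinite covariances and achievable
rates. -/
def Admissible (M : SwiptBC N KI KE) (x : Point N KI) : Prop :=
  x.r ∈ M.rateRegion x.S ∧ x.SE.PosSemidef ∧ ∀ i, (x.S i).PosSemidef

/-- Feasibility for the original problem: minimum harvested powers and maximum sum-power. -/
def FeasibleP1 (M : SwiptBC N KI KE) (x : Point N KI) : Prop :=
  M.Admissible x ∧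
    (∀ j, M.E j ≤ trMul ((∑ i, x.S i) + x.SE) (M.G j)) ∧
    ((∑ i, x.S i) + x.SE).trace.re ≤ M.Psum

/-- The optimal value of the original problem, as an extended real number. -/
def optP1 (M : SwiptBC N KI KE) : EReal :=
  sSup {v : EReal | ∃ x : Point N KI, M.FeasibleP1 x ∧ v = (M.wsr x.r : EReal)}

/-- `A = l0 I - ∑ j, l j G j`. -/
def combA (M : SwiptBC N KI KE) (l0 : ℝ) (l : Fin KE → ℝ) : Matrix (Fin N) (Fin N) ℂ :=
  (l0 : ℂ) • (1 : Matrix (Fin N) (Fin N) ℂ) - ∑ j, (l j : ℂ) • M.G j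

/-- `P_A = l0 Psum - ∑ j, l j E j`. -/
def combP (M : SwiptBC N KI KE) (l0 : ℝ) (l : Fin KE → ℝ) : ℝ :=
  l0 * M.Psum - ∑ j, l j * M.E j

/-- Feasibility for the auxiliary problem with the single combined constraint. -/
def FeasibleAux (M : SwiptBC N KI KE) (l0 : ℝ) (l : Fin KE → ℝ) (x : Point N KI) : Prop :=
  M.Admissible x ∧
    (∑ i, trMul (M.combA l0 l) (x.S i)) + trMul (M.combA l0 l) x.SE ≤ M.combP l0 l

/-- The auxiliary function: the optimal value of the auxiliary problem, which is `⊤` when the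
weighted sum-rate is unbounded there. -/
def gAux (M : SwiptBC N KI KE) (l0 : ℝ) (l : Fin KE → ℝ) : EReal :=
  sSup {v : EReal | ∃ x : Point N KI, M.FeasibleAux l0 l x ∧ v = (M.wsr x.r : EReal)}

/-- The optimal value of the minimization of the auxiliary function over nonnegative
multipliers. -/
def optP2 (M : SwiptBC N KI KE) : EReal :=
  sInf {v : EReal | ∃ (l0 : ℝ) (l : Fin KE → ℝ), 0 ≤ l0 ∧ (∀ j, 0 ≤ l j) ∧ v = M.gAux l0 l}

end SwiptBC

end

/-!
Weak duality holds because the combined constraint is a nonnegative combination of the constraints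
of (P1). For the converse, broadcast–multiple access duality turns the rates of a broadcast channel
under the constraint `Tr (A ∑ S) ≤ 1` into rates of a multiple access channel with noise covariance
`A` and total power one. With the multipliers normalised so that the power budget is one, the
weighted sum-rate of this dual channel is convex in the multipliers and concave in the powers. A
logarithmic barrier of small weight confines the multipliers to a compact set, so that Sion's
theorem provides a saddle point. Stationarity there turns the powers back into broadcast
covariances, the inverse of the noise covariance serving as energy covariance, that miss the
constraints by an arbitrarily small amount; compactness removes the error.
-/

noncomputable section

namespace SwiptBC

open scoped MatrixOrder

variable {N KI KE : ℕ} {J : Type*} [Fintype J]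

/-! ### The real trace pairing -/

/-- The rank-one matrix `v vᴴ`; `M.G j` is `outer (M.g j)` by definition. -/
def outer (v : Fin N → ℂ) : Matrix (Fin N) (Fin N) ℂ := Matrix.vecMulVec v (star v)

/-- The logarithm of the determinant of a positive definite matrix. The determinant is then a
positive real number, so that its real part loses nothing. -/
def logDet (A : Matrix (Fin N) (Fin N) ℂ) : ℝ := Real.log A.det.re

section TracePairing

variable (A B C : Matrix (Fin N) (Fin N) ℂ) (v : Fin N → ℂ) (t : ℝ) {ι : Type*} (s : Finset ι)

lemma trMul_comm : trMul A B = trMul B A := by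
  simp only [trMul, Matrix.trace_mul_comm A B]

lemma trMul_add : trMul A (B + C) = trMul A B + trMul A C := by
  simp [trMul, Matrix.mul_add]

lemma trMul_sub : trMul A (B - C) = trMul A B - trMul A C := by
  simp [trMul, Matrix.mul_sub]

lemma trMul_smul : trMul A (t • B) = t * trMul A B := by
  simp [trMul]

lemma trMul_sum (F : ι → Matrix (Fin N) (Fin N) ℂ) :
    trMul A (∑ i ∈ s, F i) = ∑ i ∈ s, trMul A (F i) := by
  simp [trMul, Matrix.mul_sum, Matrix.trace_sum]

lemma add_trMul : trMul (A + B) C = trMul A C + trMul B C := by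
  simp only [trMul_comm _ C, trMul_add]

lemma sub_trMul : trMul (A - B) C = trMul A C - trMul B C := by
  simp only [trMul_comm _ C, trMul_sub]

lemma smul_trMul : trMul (t • A) B = t * trMul A B := by
  simp only [trMul_comm _ B, trMul_smul]

lemma sum_trMul (F : ι → Matrix (Fin N) (Fin N) ℂ) :
    trMul (∑ i ∈ s, F i) A = ∑ i ∈ s, trMul (F i) A := by
  simp only [trMul_comm _ A, trMul_sum]

lemma trMul_outer : trMul A (outer v) = quad A v := by
  rw [trMul, outer, Matrix.mul_vecMulVec, Matrix.trace_vecMulVec, quad, dotProduct_comm]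

lemma quad_sub : quad (A - B) v = quad A v - quad B v := by
  simp only [← trMul_outer, sub_trMul]

lemma quad_add : quad (A + B) v = quad A v + quad B v := by
  simp only [← trMul_outer, add_trMul]

lemma quad_smul : quad (t • A) v = t * quad A v := by
  simp only [← trMul_outer, smul_trMul]

lemma quad_sum (F : ι → Matrix (Fin N) (Fin N) ℂ) :
    quad (∑ i ∈ s, F i) v = ∑ i ∈ s, quad (F i) v := by
  simp only [← trMul_outer, sum_trMul]

end TracePairing

section PositiveSemidefinite

variable {A B : Matrix (Fin N) (Fin N) ℂ}

lemma posSemidef_outer (v : Fin N → ℂ) : (outer v).PosSemidef :=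
  Matrix.posSemidef_vecMulVec_self_star v

lemma trMul_nonneg (hA : A.PosSemidef) (hB : B.PosSemidef) : 0 ≤ trMul A B := by
  obtain ⟨C, rfl⟩ := CStarAlgebra.nonneg_iff_eq_star_mul_self.mp hA.nonneg
  have h := (hB.mul_mul_conjTranspose_same C).trace_nonneg
  rw [trMul, Matrix.mul_assoc, Matrix.trace_mul_comm]
  exact (Complex.le_def.1 h).1

lemma trMul_le_trMul_left {C : Matrix (Fin N) (Fin N) ℂ} (hAB : A ≤ B) (hC : C.PosSemidef) :
    trMul A C ≤ trMul B C := by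
  have h := trMul_nonneg (Matrix.le_iff.1 hAB) hC
  rw [sub_trMul] at h
  linarith

lemma quad_mono (hAB : A ≤ B) (v : Fin N → ℂ) : quad A v ≤ quad B v := by
  simpa only [trMul_outer] using trMul_le_trMul_left hAB (posSemidef_outer v)

lemma quad_nonneg (hA : A.PosSemidef) (v : Fin N → ℂ) : 0 ≤ quad A v :=
  hA.re_dotProduct_nonneg v

lemma quad_pos (hA : A.PosDef) {v : Fin N → ℂ} (hv : v ≠ 0) : 0 < quad A v :=
  hA.re_dotProduct_pos hv

lemma star_dotProduct_mulVec_eq (hA : A.IsHermitian) (v : Fin N → ℂ) :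
    star v ⬝ᵥ (A *ᵥ v) = (quad A v : ℂ) := by
  apply Complex.ext
  · simp [quad]
  · simpa using hA.im_star_dotProduct_mulVec_self v

lemma det_re_pos (hA : A.PosDef) : 0 < A.det.re :=
  (Complex.lt_def.1 hA.det_pos).1

lemma ofReal_det_re (hA : A.PosDef) : (A.det.re : ℂ) = A.det :=
  (Complex.eq_re_of_ofReal_le hA.det_pos.le).symm

lemma isUnit_det (hA : A.PosDef) : IsUnit A.det :=
  (Matrix.isUnit_iff_isUnit_det A).1 hA.isUnit

lemma posDef_of_le (hA : A.PosDef) (hAB : A ≤ B) : B.PosDef := by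
  simpa using hA.add_posSemidef (Matrix.le_iff.1 hAB)

lemma trMul_inv_self (hA : A.PosDef) : trMul A⁻¹ A = N := by
  simp [trMul, Matrix.nonsing_inv_mul A (isUnit_det hA)]

open scoped Matrix.Norms.L2Operator in
lemma inv_le_inv_of_posDef (hA : A.PosDef) (hB : B.PosDef) (hAB : A ≤ B) : B⁻¹ ≤ A⁻¹ := by
  simpa only [Matrix.nonsing_inv_eq_ringInverse] using CStarAlgebra.antitoneOn_ringInverse
    hA.isStrictlyPositive hB.isStrictlyPositive hAB

lemma convex_posDef : Convex ℝ {A : Matrix (Fin N) (Fin N) ℂ | A.PosDef} := by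
  refine convex_iff_forall_pos.2 fun A hA B hB s t hs ht _ => ?_
  exact (Matrix.PosDef.smul hA hs).add (Matrix.PosDef.smul hB ht)

lemma isClosed_posSemidef : IsClosed {A : Matrix (Fin N) (Fin N) ℂ | A.PosSemidef} := by
  simp only [Matrix.posSemidef_iff_dotProduct_mulVec, Set.ofPred_and, Set.ofPred_forall]
  refine (isClosed_eq (by fun_prop) continuous_id).inter (isClosed_iInter fun v => ?_)
  exact isClosed_le continuous_const (by fun_prop)

end PositiveSemidefinite

/-! ### The logarithm of the determinant -/

section LogDet

variable {A B : Matrix (Fin N) (Fin N) ℂ}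

lemma exists_whitening (hA : A.PosDef) :
    ∃ D : Matrix (Fin N) (Fin N) ℂ, A⁻¹ = D * Dᴴ ∧ Dᴴ * A * D = 1 := by
  obtain ⟨C, hC⟩ := CStarAlgebra.nonneg_iff_eq_star_mul_self.mp hA.inv.posSemidef.nonneg
  have hinv : A⁻¹ = Cᴴ * Cᴴᴴ := by
    rw [hC, Matrix.conjTranspose_conjTranspose, Matrix.star_eq_conjTranspose]
  refine ⟨Cᴴ, hinv, mul_eq_one_comm.1 ?_⟩
  rw [← mul_assoc, ← hinv, Matrix.nonsing_inv_mul A (isUnit_det hA)]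

section Whitening

variable {D : Matrix (Fin N) (Fin N) ℂ}

lemma isUnit_of_whitening (hD : Dᴴ * A * D = 1) : IsUnit D :=
  .of_mul_eq_one_right _ hD

lemma posDef_whitened_iff (hD : Dᴴ * A * D = 1) : (Dᴴ * B * D).PosDef ↔ B.PosDef :=
  Matrix.IsUnit.posDef_star_left_conjugate_iff (isUnit_of_whitening hD)

lemma trMul_inv_eq_trace_whitened (hD : A⁻¹ = D * Dᴴ) (B : Matrix (Fin N) (Fin N) ℂ) :
    trMul A⁻¹ B = (Dᴴ * B * D).trace.re := by
  rw [trMul, hD, Matrix.mul_assoc, Matrix.trace_mul_comm]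

lemma logDet_sub_eq_logDet_whitened (hD : Dᴴ * A * D = 1) (hA : A.PosDef) (hB : B.PosDef) :
    logDet B - logDet A = logDet (Dᴴ * B * D) := by
  have hdet : B.det = (A.det.re : ℂ) * (Dᴴ * B * D).det := by
    have h := congrArg Matrix.det hD
    simp only [Matrix.det_mul, Matrix.det_one] at h ⊢
    rw [ofReal_det_re hA]
    linear_combination (-B.det) * h
  have hpos := det_re_pos ((posDef_whitened_iff hD).2 hB)
  rw [logDet, hdet, Complex.re_ofReal_mul, Real.log_mul (det_re_pos hA).ne' hpos.ne']
  exact add_sub_cancel_left _ _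

end Whitening

lemma det_re_eq_prod_eigenvalues (hA : A.IsHermitian) : A.det.re = ∏ i, hA.eigenvalues i := by
  rw [hA.det_eq_prod_eigenvalues]
  exact_mod_cast Complex.ofReal_re _

lemma trace_re_eq_sum_eigenvalues (hA : A.IsHermitian) :
    A.trace.re = ∑ i, hA.eigenvalues i := by
  simp [hA.trace_eq_sum_eigenvalues]

lemma logDet_le_trace_sub (hA : A.PosDef) : logDet A ≤ A.trace.re - N := by
  rw [logDet, det_re_eq_prod_eigenvalues hA.1, trace_re_eq_sum_eigenvalues hA.1,
    Real.log_prod fun i _ => (hA.eigenvalues_pos i).ne']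
  refine (Finset.sum_le_sum fun i _ => Real.log_le_sub_one_of_pos (hA.eigenvalues_pos i)).trans ?_
  simp

lemma one_sub_sum_one_sub_le_prod {ι : Type*} (s : Finset ι) {w : ι → ℝ} (h0 : ∀ i, 0 ≤ w i)
    (h1 : ∀ i, w i ≤ 1) : 1 - ∑ i ∈ s, (1 - w i) ≤ ∏ i ∈ s, w i := by
  classical
  induction s using Finset.induction_on with
  | empty => simp
  | insert a s ha ih =>
    rw [Finset.sum_insert ha, Finset.prod_insert ha]
    have hp : ∏ i ∈ s, w i ≤ 1 := Finset.prod_le_one (fun i _ => h0 i) fun i _ => h1 i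
    nlinarith [h0 a, h1 a]

lemma one_sub_det_le (hA : A.PosDef) (hA1 : A ≤ 1) : 1 - A.det.re ≤ N - A.trace.re := by
  have hle : ∀ i, hA.1.eigenvalues i ≤ 1 := fun i =>
    (le_algebraMap_iff_spectrum_le (R := ℝ) (r := 1) (a := A) hA.1).1 (by simpa) _
      (hA.1.eigenvalues_mem_spectrum_real i)
  have h := one_sub_sum_one_sub_le_prod Finset.univ (fun i => (hA.eigenvalues_pos i).le) hle
  rw [← det_re_eq_prod_eigenvalues hA.1, Finset.sum_sub_distrib,
    ← trace_re_eq_sum_eigenvalues hA.1] at h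
  simp only [Finset.sum_const, Finset.card_univ, Fintype.card_fin, nsmul_eq_mul, mul_one] at h
  linarith

lemma logDet_sub_le (hA : A.PosDef) (hB : B.PosDef) :
    logDet B - logDet A ≤ trMul A⁻¹ (B - A) := by
  obtain ⟨D, hAD, hD⟩ := exists_whitening hA
  rw [trMul_sub, trMul_inv_self hA, trMul_inv_eq_trace_whitened hAD,
    logDet_sub_eq_logDet_whitened hD hA hB]
  exact logDet_le_trace_sub ((posDef_whitened_iff hD).2 hB)

lemma one_sub_exp_le_trMul (hA : A.PosDef) (hB : B.PosDef) (hAB : A ≤ B) :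
    1 - Real.exp (-(logDet B - logDet A)) ≤ trMul B⁻¹ (B - A) := by
  obtain ⟨D, hBD, hD⟩ := exists_whitening hB
  have hX : (Dᴴ * A * D).PosDef := (posDef_whitened_iff hD).2 hA
  have hX1 : Dᴴ * A * D ≤ 1 := hD ▸ star_left_conjugate_le_conjugate hAB D
  rw [neg_sub, logDet_sub_eq_logDet_whitened hD hB hA, logDet, Real.exp_log (det_re_pos hX),
    trMul_sub, trMul_inv_self hB, trMul_inv_eq_trace_whitened hBD]
  exact one_sub_det_le hX hX1

lemma logDet_mono (hA : A.PosDef) (hB : B.PosDef) (hAB : A ≤ B) : logDet A ≤ logDet B := by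
  have h := logDet_sub_le hB hA
  have h2 := trMul_nonneg hB.inv.posSemidef (Matrix.le_iff.1 hAB)
  rw [trMul_sub] at h h2
  linarith

lemma concaveOn_logDet :
    ConcaveOn ℝ {A : Matrix (Fin N) (Fin N) ℂ | A.PosDef} logDet := by
  refine ⟨convex_posDef, fun A hA B hB s t hs ht hst => ?_⟩
  set C := s • A + t • B
  have hC : C.PosDef := convex_posDef hA hB hs ht hst
  have hAC := mul_le_mul_of_nonneg_left (logDet_sub_le hC hA) hs
  have hBC := mul_le_mul_of_nonneg_left (logDet_sub_le hC hB) ht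
  have hzero : s * trMul C⁻¹ (A - C) + t * trMul C⁻¹ (B - C) = 0 := by
    have : s • (A - C) + t • (B - C) = 0 := by
      rw [smul_sub, smul_sub, sub_add_sub_comm, ← add_smul, hst, one_smul, sub_self]
    rw [← trMul_smul, ← trMul_smul, ← trMul_add, this]
    simp [trMul]
  simp only [smul_eq_mul]
  linear_combination hAC + hBC + hzero + hst * logDet C

lemma continuousOn_logDet :
    ContinuousOn (logDet : Matrix (Fin N) (Fin N) ℂ → ℝ) {A | A.PosDef} := by
  have h : Continuous fun A : Matrix (Fin N) (Fin N) ℂ => A.det.re := by fun_prop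
  exact h.continuousOn.log fun A hA => (det_re_pos hA).ne'

lemma hasDerivAt_det_one_add_smul (X : Matrix (Fin N) (Fin N) ℂ) :
    HasDerivAt (fun z : ℂ => (1 + z • X).det) X.trace 0 := by
  rw [funext fun z : ℂ => Matrix.det_one_add_smul z X]
  generalize (Matrix.det (1 + (Polynomial.X : Polynomial ℂ) • X.map Polynomial.C)).divX.divX = P
  exact ((((hasDerivAt_id (0 : ℂ)).const_mul X.trace).const_add 1).add
    ((P.hasDerivAt 0).mul ((hasDerivAt_id (0 : ℂ)).pow 2))).congr_deriv (by simp)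

lemma hasDerivAt_logDet (hA : A.PosDef) (B : Matrix (Fin N) (Fin N) ℂ) :
    HasDerivAt (fun t : ℝ => logDet (A + t • B)) (trMul A⁻¹ B) 0 := by
  have hdet (t : ℝ) : (A + t • B).det.re = A.det.re * (1 + (t : ℂ) • (A⁻¹ * B)).det.re := by
    rw [← Complex.re_ofReal_mul, ofReal_det_re hA, ← Matrix.det_mul, mul_add, mul_one,
      mul_smul_comm, ← mul_assoc, Matrix.mul_nonsing_inv A (isUnit_det hA), one_mul,
      Complex.coe_smul]
  have hderiv : HasDerivAt (fun t : ℝ => (1 + (t : ℂ) • (A⁻¹ * B)).det.re) (trMul A⁻¹ B) 0 :=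
    HasDerivAt.real_of_complex (z := 0) (e := fun z : ℂ => (1 + z • (A⁻¹ * B)).det)
      (by simpa using hasDerivAt_det_one_add_smul (A⁻¹ * B))
  have hpos := det_re_pos hA
  unfold logDet
  simp only [hdet]
  convert (hderiv.const_mul A.det.re).log (by simpa using hpos.ne') using 1
  simp [mul_div_cancel_left₀ _ hpos.ne']

open scoped Matrix.Norms.L2Operator in
lemma eventually_posDef_add_smul (hA : A.PosDef) (hB : B.IsHermitian) :
    ∀ᶠ t : ℝ in nhds 0, (A + t • B).PosDef := by
  obtain ⟨D, -, hD⟩ := exists_whitening hA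
  set X := Dᴴ * B * D
  have hsmall : ∀ᶠ t : ℝ in nhds 0, ‖t • X‖ < 1 :=
    (by fun_prop : Continuous fun t : ℝ => ‖t • X‖).continuousAt.eventually_lt_const (by simp)
  filter_upwards [hsmall] with t ht
  have hX : (t • X).IsHermitian := by
    have hX : X.IsHermitian := Matrix.isHermitian_conjTranspose_mul_mul D hB
    exact hX.smul (.all t)
  have hgap : ((1 - ‖t • X‖) • (1 : Matrix (Fin N) (Fin N) ℂ)).PosDef :=
    Matrix.PosDef.one.smul (sub_pos.2 ht)
  have hle : (1 - ‖t • X‖) • (1 : Matrix (Fin N) (Fin N) ℂ) ≤ 1 + t • X := by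
    have := IsSelfAdjoint.neg_algebraMap_norm_le_self (a := t • X) hX
    rw [Algebra.algebraMap_eq_smul_one] at this
    rw [sub_smul, one_smul, sub_eq_add_neg]
    gcongr
  rw [← posDef_whitened_iff hD]
  have hsplit : Dᴴ * (A + t • B) * D = 1 + t • X := by
    rw [mul_add, add_mul, hD, mul_smul_comm, smul_mul_assoc]
  rw [hsplit]
  exact posDef_of_le hgap hle

end LogDet

/-! ### Rank-one updates -/

section RankOne

variable {A B S : Matrix (Fin N) (Fin N) ℂ}

lemma posDef_add_smul_outer (hA : A.PosDef) {q : ℝ} (hq : 0 ≤ q) (v : Fin N → ℂ) :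
    (A + q • outer v).PosDef :=
  hA.add_posSemidef ((posSemidef_outer v).smul hq)

lemma one_add_mul_quad_inv_pos (hA : A.PosDef) {q : ℝ} (hq : 0 ≤ q) (v : Fin N → ℂ) :
    0 < 1 + q * quad A⁻¹ v :=
  add_pos_of_pos_of_nonneg one_pos (mul_nonneg hq (quad_nonneg hA.inv.posSemidef v))

lemma outer_mulVec (v w : Fin N → ℂ) : outer v *ᵥ w = (star v ⬝ᵥ w) • v := by
  rw [outer, Matrix.vecMulVec_mulVec, op_smul_eq_smul]

lemma logDet_add_smul_outer (hA : A.PosDef) {q : ℝ} (hq : 0 ≤ q) (v : Fin N → ℂ) :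
    logDet (A + q • outer v) = logDet A + Real.log (1 + q * quad A⁻¹ v) := by
  have hdet : (A + q • outer v).det = A.det * ((1 + q * quad A⁻¹ v : ℝ) : ℂ) := by
    have hfactor : A + q • outer v = A * (1 + Matrix.replicateCol Unit ((q : ℂ) • A⁻¹ *ᵥ v) *
        Matrix.replicateRow Unit (star v)) := by
      rw [← Matrix.vecMulVec_eq, mul_add, mul_one, Matrix.mul_vecMulVec, Matrix.mulVec_smul,
        Matrix.mulVec_mulVec, Matrix.mul_nonsing_inv A (isUnit_det hA), Matrix.one_mulVec,
        Matrix.smul_vecMulVec, Complex.coe_smul, outer]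
    rw [hfactor, Matrix.det_mul, Matrix.det_one_add_replicateCol_mul_replicateRow,
      dotProduct_smul, star_dotProduct_mulVec_eq hA.inv.1]
    push_cast
    rfl
  rw [logDet, hdet, Complex.re_mul_ofReal,
    Real.log_mul (det_re_pos hA).ne' (one_add_mul_quad_inv_pos hA hq v).ne']
  rfl

lemma quad_inv_add_smul_outer (hA : A.PosDef) {q : ℝ} (hq : 0 ≤ q) (v : Fin N → ℂ) :
    quad (A + q • outer v)⁻¹ v * (1 + q * quad A⁻¹ v) = quad A⁻¹ v := by
  have hC := posDef_add_smul_outer hA hq v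
  have hCv : (A + q • outer v) *ᵥ (A⁻¹ *ᵥ v) = (1 + q * quad A⁻¹ v) • v := by
    rw [Matrix.add_mulVec, Matrix.mulVec_mulVec, Matrix.mul_nonsing_inv A (isUnit_det hA),
      Matrix.one_mulVec, Matrix.smul_mulVec, outer_mulVec, star_dotProduct_mulVec_eq hA.inv.1,
      Complex.coe_smul, smul_smul, add_smul, one_smul]
  have hv : A⁻¹ *ᵥ v = (1 + q * quad A⁻¹ v) • ((A + q • outer v)⁻¹ *ᵥ v) := by
    rw [← Matrix.mulVec_smul, ← hCv, Matrix.mulVec_mulVec,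
      Matrix.nonsing_inv_mul _ (isUnit_det hC), Matrix.one_mulVec]
  rw [mul_comm]
  conv_rhs => rw [quad, hv, dotProduct_smul, Complex.smul_re, smul_eq_mul, ← quad]

lemma outer_le_smul_one (w : Fin N → ℂ) : outer w ≤ (star w ⬝ᵥ w).re • 1 := by
  set c : ℝ := (star w ⬝ᵥ w).re
  have hc : star w ⬝ᵥ w = (c : ℂ) := by
    simpa [quad] using star_dotProduct_mulVec_eq Matrix.isHermitian_one w
  have hc0 : 0 ≤ c := by simpa [quad] using quad_nonneg Matrix.PosSemidef.one w
  rcases hc0.eq_or_lt with h0 | hpos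
  · have hw : w = 0 := dotProduct_star_self_eq_zero.1 (by
      rw [dotProduct_comm]; simpa [← h0] using hc)
    simp [← h0, hw, outer]
  have hsq : outer w * outer w = c • outer w := by
    rw [outer, Matrix.vecMulVec_mul_vecMulVec, hc]
    simp
  have hH : (outer w)ᴴ = outer w := (posSemidef_outer w).1
  have hsquare : (c • 1 - outer w)ᴴ * (c • 1 - outer w) = c • (c • 1 - outer w) := by
    simp only [Matrix.conjTranspose_sub, Matrix.conjTranspose_smul, Matrix.conjTranspose_one, hH,
      sub_mul, mul_sub, hsq, smul_sub, star_trivial]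
    simp
  rw [Matrix.le_iff]
  have h := (Matrix.posSemidef_conjTranspose_mul_self (c • 1 - outer w)).smul
    (inv_nonneg.2 hc0)
  rwa [hsquare, inv_smul_smul₀ hpos.ne'] at h

lemma conjTranspose_mul_outer_mul (D : Matrix (Fin N) (Fin N) ℂ) (v : Fin N → ℂ) :
    Dᴴ * outer v * D = outer (Dᴴ *ᵥ v) := by
  rw [outer, outer, Matrix.mul_vecMulVec, Matrix.vecMulVec_mul, Matrix.star_mulVec,
    Matrix.conjTranspose_conjTranspose]

lemma outer_le_quad_inv_smul (hA : A.PosDef) (v : Fin N → ℂ) :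
    outer v ≤ quad A⁻¹ v • A := by
  obtain ⟨D, hAD, hD⟩ := exists_whitening hA
  have hq : quad A⁻¹ v = (star (Dᴴ *ᵥ v) ⬝ᵥ (Dᴴ *ᵥ v)).re := by
    rw [quad, hAD, ← Matrix.mulVec_mulVec, Matrix.dotProduct_mulVec, Matrix.star_mulVec,
      Matrix.conjTranspose_conjTranspose]
  rw [Matrix.le_iff, ← Matrix.IsUnit.posSemidef_star_left_conjugate_iff (isUnit_of_whitening hD),
    Matrix.star_eq_conjTranspose, mul_sub, sub_mul, conjTranspose_mul_outer_mul, hq,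
    mul_smul_comm, smul_mul_assoc, hD, ← Matrix.le_iff]
  exact outer_le_smul_one _

lemma quad_le_quad_inv_mul_trMul (hA : A.PosDef) (hS : S.PosSemidef) (v : Fin N → ℂ) :
    quad S v ≤ quad A⁻¹ v * trMul A S := by
  rw [← smul_trMul, ← trMul_outer, trMul_comm]
  exact trMul_le_trMul_left (outer_le_quad_inv_smul hA v) hS

open scoped Matrix.Norms.L2Operator in
lemma convexOn_quad_inv (v : Fin N → ℂ) :
    ConvexOn ℝ {A : Matrix (Fin N) (Fin N) ℂ | A.PosDef} fun A => quad A⁻¹ v := by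
  refine ⟨convex_posDef, fun A hA B hB s t hs ht hst => ?_⟩
  have h := CStarAlgebra.convexOn_ringInverse.2 (Matrix.PosDef.isStrictlyPositive hA)
    (Matrix.PosDef.isStrictlyPositive hB) hs ht hst
  simp only [← Matrix.nonsing_inv_eq_ringInverse] at h
  simpa only [quad_add, quad_smul, smul_eq_mul] using quad_mono h v

lemma one_sub_mul_quad_inv_add_smul_outer (hA : A.PosDef) {q : ℝ} (hq : 0 ≤ q)
    (v : Fin N → ℂ) : 1 - q * quad (A + q • outer v)⁻¹ v = (1 + q * quad A⁻¹ v)⁻¹ := by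
  apply eq_inv_of_mul_eq_one_left
  linear_combination (-q) * quad_inv_add_smul_outer hA hq v

lemma convexOn_logDet_add_smul_outer_sub {q : ℝ} (hq : 0 ≤ q) (v : Fin N → ℂ) :
    ConvexOn ℝ {A : Matrix (Fin N) (Fin N) ℂ | A.PosDef}
      fun A => logDet (A + q • outer v) - logDet A := by
  -- By the determinant lemma the function is `-log φ`, where `φ` is concave and positive.
  set φ : Matrix (Fin N) (Fin N) ℂ → ℝ := fun A => 1 - q * quad (A + q • outer v)⁻¹ v
  have hφ_inv : ∀ A, A.PosDef → φ A = (1 + q * quad A⁻¹ v)⁻¹ := fun A hA =>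
    one_sub_mul_quad_inv_add_smul_outer hA hq v
  have hφ_pos : ∀ A, A.PosDef → 0 < φ A := fun A hA => by
    rw [hφ_inv A hA]
    exact inv_pos.2 (one_add_mul_quad_inv_pos hA hq v)
  have hφ_log : ∀ A, A.PosDef → logDet (A + q • outer v) - logDet A = -Real.log (φ A) :=
    fun A hA => by
      rw [hφ_inv A hA, Real.log_inv, neg_neg, logDet_add_smul_outer hA hq, add_sub_cancel_left]
  refine ⟨convex_posDef, fun A hA B hB s t hs ht hst => ?_⟩
  have hC := convex_posDef hA hB hs ht hst
  have hconc : s * φ A + t * φ B ≤ φ (s • A + t • B) := by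
    have h := mul_le_mul_of_nonneg_left ((convexOn_quad_inv v).2 (posDef_add_smul_outer hA hq v)
      (posDef_add_smul_outer hB hq v) hs ht hst) hq
    have hsum : s • (A + q • outer v) + t • (B + q • outer v) = s • A + t • B + q • outer v := by
      rw [smul_add, smul_add, add_add_add_comm, ← add_smul, hst, one_smul]
    rw [hsum, smul_eq_mul, smul_eq_mul] at h
    linear_combination h + hst
  have hlog := strictConcaveOn_log_Ioi.concaveOn.2 (hφ_pos A hA) (hφ_pos B hB) hs ht hst
  have hmono := Real.log_le_log
    (strictConcaveOn_log_Ioi.1 (hφ_pos A hA) (hφ_pos B hB) hs ht hst) hconc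
  simp only [hφ_log A hA, hφ_log B hB, hφ_log _ hC, smul_eq_mul] at hlog hmono ⊢
  linarith

end RankOne

/-! ### The dual multiple access channel -/

/-- The received covariance of the dual multiple access channel with noise covariance `A` when the
users in `s` transmit with powers `q`. Users are indexed by `ℕ`, so that a channel with `K` users
uses only the indices below `K`. -/
def macCov (A : Matrix (Fin N) (Fin N) ℂ) (h : ℕ → Fin N → ℂ) (q : ℕ → ℝ) (s : Finset ℕ) :
    Matrix (Fin N) (Fin N) ℂ :=
  A + ∑ k ∈ s, q k • outer (h k)

section MacCov

variable {A B : Matrix (Fin N) (Fin N) ℂ} {h : ℕ → Fin N → ℂ} {p q : ℕ → ℝ} {s t : Finset ℕ}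

lemma macCov_empty : macCov A h q ∅ = A := by
  simp only [macCov, Finset.sum_empty, add_zero]

lemma macCov_insert {k : ℕ} (hk : k ∉ s) :
    macCov A h q (insert k s) = macCov A h q s + q k • outer (h k) := by
  rw [macCov, Finset.sum_insert hk, macCov, add_comm (q k • _), add_assoc]

lemma macCov_mono (hq : 0 ≤ q) (hpq : p ≤ q) (hst : s ⊆ t) :
    macCov A h p s ≤ macCov A h q t := by
  unfold macCov
  gcongr
  calc ∑ k ∈ s, p k • outer (h k) ≤ ∑ k ∈ s, q k • outer (h k) :=
        Finset.sum_le_sum fun k _ => by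
          rw [Matrix.le_iff, ← sub_smul]
          exact (posSemidef_outer (h k)).smul (sub_nonneg.2 (hpq k))
    _ ≤ ∑ k ∈ t, q k • outer (h k) :=
        Finset.sum_le_sum_of_subset_of_nonneg hst fun k _ _ =>
          ((posSemidef_outer (h k)).smul (hq k)).nonneg

lemma le_macCov (hq : 0 ≤ q) : A ≤ macCov A h q s := by
  conv_lhs => rw [← macCov_empty (A := A) (h := h) (q := q)]
  exact macCov_mono hq le_rfl s.empty_subset

lemma posDef_macCov (hA : A.PosDef) (hq : 0 ≤ q) : (macCov A h q s).PosDef :=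
  posDef_of_le hA (le_macCov hq)

lemma macCov_smul_add_smul (x y : ℝ) :
    macCov (x • A + y • B) h (x • p + y • q) s = x • macCov A h p s + y • macCov B h q s := by
  simp only [macCov, Pi.add_apply, Pi.smul_apply, smul_eq_mul, add_smul, mul_smul,
    Finset.sum_add_distrib, Finset.smul_sum, smul_add]
  abel

lemma macCov_add_smul (t : ℝ) :
    macCov (A + t • B) h (p + t • q) s = macCov A h p s + t • macCov B h q s := by
  simpa only [one_smul] using macCov_smul_add_smul (A := A) (p := p) 1 t

lemma trMul_macCov (C : Matrix (Fin N) (Fin N) ℂ) :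
    trMul C (macCov A h q s) = trMul C A + ∑ k ∈ s, q k * quad C (h k) := by
  simp only [macCov, trMul_add, trMul_sum, trMul_smul, trMul_outer]

/-- Successive decoding achieves a point of the polymatroid of the multiple access channel: the
interference of the users decoded later outweighs that of the users in `U` alone. -/
lemma sum_log_le_logDet_macCov (hA : A.PosDef) (hq : 0 ≤ q) (U : Finset ℕ) :
    ∑ i ∈ U, Real.log (1 + q i * quad (macCov A h q (Finset.range i))⁻¹ (h i)) ≤
      logDet (macCov A h q U) - logDet A := by
  induction U using Finset.induction_on_max with
  | empty => simp [macCov_empty]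
  | insert m U hm ih =>
    have hmU : m ∉ U := fun hmem => lt_irrefl m (hm m hmem)
    have hU : (macCov A h q U).PosDef := posDef_macCov hA hq
    have hR : (macCov A h q (Finset.range m)).PosDef := posDef_macCov hA hq
    have hUR : macCov A h q U ≤ macCov A h q (Finset.range m) :=
      macCov_mono hq le_rfl fun k hk => Finset.mem_range.2 (hm k hk)
    rw [Finset.sum_insert hmU, macCov_insert hmU, logDet_add_smul_outer hU (hq m)]
    have hlog : Real.log (1 + q m * quad (macCov A h q (Finset.range m))⁻¹ (h m)) ≤
        Real.log (1 + q m * quad (macCov A h q U)⁻¹ (h m)) := by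
      have hquad := quad_mono (inv_le_inv_of_posDef hU hR hUR) (h m)
      have hqm := hq m
      exact Real.log_le_log (one_add_mul_quad_inv_pos hR hqm _) (by gcongr)
    linarith

end MacCov

/-! ### Multiple access powers for given broadcast rates -/

/-- The covariance of the signals that a broadcast channel with `K` users, encoded in increasing
order, encodes from place `i` on. -/
def bcTail (K : ℕ) (S : ℕ → Matrix (Fin N) (Fin N) ℂ) (i : ℕ) : Matrix (Fin N) (Fin N) ℂ :=
  ∑ k ∈ Finset.Ico i K, S k

/-- The rate (in nats) of user `i` in the broadcast channel with unit noise when the users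
`0, …, K - 1` are encoded in increasing order. -/
def bcRate (K : ℕ) (h : ℕ → Fin N → ℂ) (S : ℕ → Matrix (Fin N) (Fin N) ℂ) (i : ℕ) : ℝ :=
  Real.log ((1 + quad (bcTail K S i) (h i)) / (1 + quad (bcTail K S (i + 1)) (h i)))

/-- The signal-to-interference-and-noise ratio of user `i` in the broadcast channel. -/
def bcSinr (K : ℕ) (h : ℕ → Fin N → ℂ) (S : ℕ → Matrix (Fin N) (Fin N) ℂ) (i : ℕ) : ℝ :=
  quad (S i) (h i) / (1 + quad (bcTail K S (i + 1)) (h i))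

/-- The received covariances of the dual multiple access channel in which the powers are chosen
successively so that user `i` has signal-to-interference-and-noise ratio `γ i`. -/
def sinrCov (A : Matrix (Fin N) (Fin N) ℂ) (h : ℕ → Fin N → ℂ) (γ : ℕ → ℝ) :
    ℕ → Matrix (Fin N) (Fin N) ℂ
  | 0 => A
  | i + 1 => sinrCov A h γ i + (γ i / quad (sinrCov A h γ i)⁻¹ (h i)) • outer (h i)

/-- The power of user `i` in the dual multiple access channel with received covariances
`sinrCov A h γ`. -/
def sinrPower (A : Matrix (Fin N) (Fin N) ℂ) (h : ℕ → Fin N → ℂ) (γ : ℕ → ℝ) (i : ℕ) : ℝ :=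
  γ i / quad (sinrCov A h γ i)⁻¹ (h i)

section MacPowers

variable {K : ℕ} {h : ℕ → Fin N → ℂ} {S : ℕ → Matrix (Fin N) (Fin N) ℂ}

lemma bcTail_eq_add {i : ℕ} (hi : i < K) : bcTail K S i = S i + bcTail K S (i + 1) :=
  Finset.sum_eq_sum_Ico_succ_bot hi S

lemma one_add_quad_bcTail_pos (hS : ∀ k, (S k).PosSemidef) (i : ℕ) (v : Fin N → ℂ) :
    0 < 1 + quad (bcTail K S i) v :=
  add_pos_of_pos_of_nonneg one_pos (quad_nonneg (Matrix.posSemidef_sum _ fun k _ => hS k) v)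

lemma bcSinr_nonneg (hS : ∀ k, (S k).PosSemidef) : 0 ≤ bcSinr K h S := fun i =>
  div_nonneg (quad_nonneg (hS i) _) (one_add_quad_bcTail_pos hS _ _).le

lemma bcRate_eq_log_one_add_bcSinr (hS : ∀ k, (S k).PosSemidef) {i : ℕ} (hi : i < K) :
    bcRate K h S i = Real.log (1 + bcSinr K h S i) := by
  rw [bcRate, bcTail_eq_add hi, quad_add, bcSinr,
    one_add_div (one_add_quad_bcTail_pos hS _ _).ne']
  congr 2
  ring

section SinrPower

variable {A : Matrix (Fin N) (Fin N) ℂ} {γ : ℕ → ℝ}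

lemma macCov_sinrPower (i : ℕ) :
    macCov A h (sinrPower A h γ) (Finset.range i) = sinrCov A h γ i := by
  induction i with
  | zero => exact macCov_empty
  | succ i ih =>
    rw [Finset.range_add_one, macCov_insert Finset.notMem_range_self, ih]
    rfl

lemma posDef_sinrCov (hA : A.PosDef) (hγ : 0 ≤ γ) (i : ℕ) : (sinrCov A h γ i).PosDef := by
  induction i with
  | zero => exact hA
  | succ i ih =>
    exact posDef_add_smul_outer ih (div_nonneg (hγ i) (quad_nonneg ih.inv.posSemidef _)) _

lemma sinrPower_nonneg (hA : A.PosDef) (hγ : 0 ≤ γ) : 0 ≤ sinrPower A h γ := fun i =>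
  div_nonneg (hγ i) (quad_nonneg (posDef_sinrCov hA hγ i).inv.posSemidef _)

lemma sinrPower_mul_quad_inv (hA : A.PosDef) (hγ : 0 ≤ γ) {i : ℕ} (hi : h i = 0 → γ i = 0) :
    sinrPower A h γ i * quad (sinrCov A h γ i)⁻¹ (h i) = γ i := by
  by_cases hv : h i = 0
  · simp [hv, hi hv, quad]
  · exact div_mul_cancel₀ _ (quad_pos (posDef_sinrCov hA hγ i).inv hv).ne'

end SinrPower

variable {A : Matrix (Fin N) (Fin N) ℂ}

lemma sinrPower_mul_le_trMul (hA : A.PosDef) (hS : ∀ k, (S k).PosSemidef) (i : ℕ) :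
    sinrPower A h (bcSinr K h S) i * (1 + quad (bcTail K S (i + 1)) (h i)) ≤
      trMul (sinrCov A h (bcSinr K h S) i) (S i) := by
  have hcov := posDef_sinrCov (h := h) hA (bcSinr_nonneg (K := K) (h := h) hS) i
  have hpower : sinrPower A h (bcSinr K h S) i * (1 + quad (bcTail K S (i + 1)) (h i)) =
      quad (S i) (h i) / quad (sinrCov A h (bcSinr K h S) i)⁻¹ (h i) := by
    rw [sinrPower, bcSinr, div_mul_eq_mul_div,
      div_mul_cancel₀ _ (one_add_quad_bcTail_pos hS _ _).ne']
  rw [hpower]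
  refine div_le_of_le_mul₀ (quad_nonneg hcov.inv.posSemidef _)
    (trMul_nonneg hcov.posSemidef (hS i)) ?_
  rw [mul_comm]
  exact quad_le_quad_inv_mul_trMul hcov (hS i) (h i)

lemma sum_sinrPower_le (hA : A.PosDef) (hS : ∀ k, (S k).PosSemidef) :
    ∑ k ∈ Finset.range K, sinrPower A h (bcSinr K h S) k ≤
      ∑ k ∈ Finset.range K, trMul A (S k) := by
  set q := sinrPower A h (bcSinr K h S)
  have htr : ∀ i, trMul (sinrCov A h (bcSinr K h S) i) (S i) =
      trMul A (S i) + ∑ k ∈ Finset.range i, q k * quad (S i) (h k) := fun i => by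
    rw [← macCov_sinrPower, trMul_comm, trMul_macCov, trMul_comm]
  have hswap : ∑ i ∈ Finset.range K, ∑ k ∈ Finset.range i, q k * quad (S i) (h k) =
      ∑ i ∈ Finset.range K, q i * quad (bcTail K S (i + 1)) (h i) := by
    simp only [bcTail, quad_sum, Finset.mul_sum]
    refine Finset.sum_comm' fun i k => ?_
    simp only [Finset.mem_range, Finset.mem_Ico]
    omega
  have hsum := Finset.sum_le_sum fun i (_ : i ∈ Finset.range K) =>
    sinrPower_mul_le_trMul (K := K) (h := h) hA hS i
  simp only [htr, mul_add, mul_one, Finset.sum_add_distrib, hswap] at hsum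
  exact le_of_add_le_add_right hsum

lemma exists_mac_powers (hA : A.PosDef) (hS : ∀ k, (S k).PosSemidef) :
    ∃ q : ℕ → ℝ, 0 ≤ q ∧
      ∑ k ∈ Finset.range K, q k ≤ ∑ k ∈ Finset.range K, trMul A (S k) ∧
      ∀ U ⊆ Finset.range K, ∑ i ∈ U, bcRate K h S i ≤ logDet (macCov A h q U) - logDet A := by
  have hγ := bcSinr_nonneg (K := K) (h := h) hS
  refine ⟨sinrPower A h (bcSinr K h S), sinrPower_nonneg hA hγ, sum_sinrPower_le hA hS,
    fun U hU => ?_⟩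
  refine le_of_eq_of_le (Finset.sum_congr rfl fun i hi => ?_)
    (sum_log_le_logDet_macCov hA (sinrPower_nonneg hA hγ) U)
  rw [bcRate_eq_log_one_add_bcSinr hS (Finset.mem_range.1 (hU hi)), macCov_sinrPower,
    sinrPower_mul_quad_inv hA hγ]
  intro hv
  simp [bcSinr, hv, quad]

end MacPowers

/-! ### The weighted sum-rate of the dual channel -/

/-- The largest weighted sum-rate (in nats) of the dual multiple access channel with noise
covariance `A` and powers `q`, for nonincreasing weights `a` with `a K = 0`: successive decoding in
decreasing order, summed by parts. -/
def macWsr (K : ℕ) (h : ℕ → Fin N → ℂ) (a : ℕ → ℝ) (A : Matrix (Fin N) (Fin N) ℂ) (q : ℕ → ℝ) : ℝ :=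
  ∑ i ∈ Finset.range K,
    (a i - a (i + 1)) * (logDet (macCov A h q (Finset.range (i + 1))) - logDet A)

/-- The partial derivative of `macWsr` with respect to the power of user `k`. -/
def macGrad (K : ℕ) (h : ℕ → Fin N → ℂ) (a : ℕ → ℝ) (A : Matrix (Fin N) (Fin N) ℂ) (q : ℕ → ℝ)
    (k : ℕ) : ℝ :=
  ∑ i ∈ Finset.Ico k K, (a i - a (i + 1)) * quad (macCov A h q (Finset.range (i + 1)))⁻¹ (h k)

/-- The negative of the gradient of `macWsr` with respect to the noise covariance. -/
def macNoiseGrad (K : ℕ) (h : ℕ → Fin N → ℂ) (a : ℕ → ℝ) (A : Matrix (Fin N) (Fin N) ℂ)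
    (q : ℕ → ℝ) : Matrix (Fin N) (Fin N) ℂ :=
  a 0 • A⁻¹ -
    ∑ i ∈ Finset.range K, (a i - a (i + 1)) • (macCov A h q (Finset.range (i + 1)))⁻¹

/-- The power allocations of total power one among the users `0, …, K - 1`. -/
def powerSimplex (K : ℕ) : Set (ℕ → ℝ) :=
  {p | 0 ≤ p ∧ (∀ k, K ≤ k → p k = 0) ∧ ∑ k ∈ Finset.range K, p k = 1}

section PowerSimplex

variable {K : ℕ} {p : ℕ → ℝ}

lemma le_one_of_mem_powerSimplex (hp : p ∈ powerSimplex K) (k : ℕ) : p k ≤ 1 := by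
  by_cases hk : k < K
  · rw [← hp.2.2]
    exact Finset.single_le_sum (fun i _ => hp.1 i) (Finset.mem_range.2 hk)
  · rw [hp.2.1 k (not_lt.1 hk)]
    exact zero_le_one

lemma single_mem_powerSimplex {l : ℕ} (hl : l < K) : Pi.single l 1 ∈ powerSimplex K :=
  ⟨Pi.single_nonneg.2 zero_le_one, fun _ hk => Pi.single_eq_of_ne (by omega) _, by simp [hl]⟩

lemma isCompact_powerSimplex (K : ℕ) : IsCompact (powerSimplex K) := by
  refine (isCompact_univ_pi fun _ : ℕ => isCompact_Icc (a := (0 : ℝ)) (b := 1)).of_isClosed_subset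
    ?_ fun p hp k _ => ⟨hp.1 k, le_one_of_mem_powerSimplex hp k⟩
  have hzero : IsClosed {p : ℕ → ℝ | ∀ k, K ≤ k → p k = 0} := by
    simp only [Set.ofPred_forall]
    exact isClosed_iInter fun k => isClosed_iInter fun _ =>
      isClosed_eq (continuous_apply k) continuous_const
  exact isClosed_Ici.inter (hzero.inter (isClosed_eq (by fun_prop) continuous_const))

lemma convex_powerSimplex (K : ℕ) : Convex ℝ (powerSimplex K) := by
  intro p hp r hr x y hx hy hxy
  refine ⟨convex_Ici (0 : ℕ → ℝ) hp.1 hr.1 hx hy hxy, fun k hk => ?_, ?_⟩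
  · simp [hp.2.1 k hk, hr.2.1 k hk]
  · simp [Finset.sum_add_distrib, ← Finset.mul_sum, hp.2.2, hr.2.2, hxy]

end PowerSimplex

section MacWsr

variable {K : ℕ} {h : ℕ → Fin N → ℂ} {a : ℕ → ℝ} {A : Matrix (Fin N) (Fin N) ℂ} {q r : ℕ → ℝ}

lemma sum_range_mul_eq_by_parts (a b : ℕ → ℝ) (K : ℕ) :
    ∑ i ∈ Finset.range K, a i * b i =
      ∑ i ∈ Finset.range K, (a i - a (i + 1)) * ∑ k ∈ Finset.range (i + 1), b k +
        a K * ∑ k ∈ Finset.range K, b k := by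
  induction K with
  | zero => simp
  | succ K ih =>
    rw [Finset.sum_range_succ, ih, Finset.sum_range_succ _ K, Finset.sum_range_succ b K]
    ring

lemma sum_weight_sub (haK : a K = 0) : ∑ i ∈ Finset.range K, (a i - a (i + 1)) = a 0 := by
  rw [Finset.sum_range_sub' a K, haK, sub_zero]

lemma weight_sub_nonneg (ha : Antitone a) (i : ℕ) : 0 ≤ a i - a (i + 1) :=
  sub_nonneg.2 (ha i.le_succ)

lemma macWsr_mono (ha : Antitone a) (hA : A.PosDef) (hq : 0 ≤ q) (hqr : q ≤ r) :
    macWsr K h a A q ≤ macWsr K h a A r := by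
  have hr := hq.trans hqr
  refine Finset.sum_le_sum fun i _ => mul_le_mul_of_nonneg_left ?_ (weight_sub_nonneg ha i)
  gcongr
  exact logDet_mono (posDef_macCov hA hq) (posDef_macCov hA hr) (macCov_mono hr hqr subset_rfl)

lemma macWsr_nonneg (ha : Antitone a) (hA : A.PosDef) (hq : 0 ≤ q) : 0 ≤ macWsr K h a A q :=
  Finset.sum_nonneg fun i _ => mul_nonneg (weight_sub_nonneg ha i) <| sub_nonneg.2 <|
    logDet_mono hA (posDef_macCov hA hq) (le_macCov hq)

lemma macWsr_eq_sum_mul_sub (haK : a K = 0) :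
    macWsr K h a A q = ∑ i ∈ Finset.range K, a i *
      (logDet (macCov A h q (Finset.range (i + 1))) - logDet (macCov A h q (Finset.range i))) := by
  rw [sum_range_mul_eq_by_parts, haK, zero_mul, add_zero, macWsr]
  refine Finset.sum_congr rfl fun i _ => ?_
  rw [Finset.sum_range_sub fun k => logDet (macCov A h q (Finset.range k)), Finset.range_zero,
    macCov_empty]

lemma concaveOn_macWsr (ha : Antitone a) (hA : A.PosDef) :
    ConcaveOn ℝ (Set.Ici 0) (macWsr K h a A) := by
  refine ⟨convex_Ici 0, fun q hq r hr x y hx hy hxy => ?_⟩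
  simp only [macWsr, smul_eq_mul, Finset.mul_sum, ← Finset.sum_add_distrib]
  refine Finset.sum_le_sum fun i _ => ?_
  have hcov := macCov_smul_add_smul (A := A) (B := A) (h := h) (p := q) (q := r)
    (s := Finset.range (i + 1)) x y
  rw [← add_smul, hxy, one_smul] at hcov
  have hlog := concaveOn_logDet.2 (posDef_macCov (h := h) (s := Finset.range (i + 1)) hA hq)
    (posDef_macCov (h := h) (s := Finset.range (i + 1)) hA hr) hx hy hxy
  rw [← hcov, smul_eq_mul, smul_eq_mul] at hlog
  have hw := mul_le_mul_of_nonneg_left hlog (weight_sub_nonneg ha i)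
  linear_combination hw - (a i - a (i + 1)) * logDet A * hxy

lemma convexOn_logDet_macCov_sub (hq : 0 ≤ q) (s : Finset ℕ) :
    ConvexOn ℝ {A : Matrix (Fin N) (Fin N) ℂ | A.PosDef}
      fun A => logDet (macCov A h q s) - logDet A := by
  induction s using Finset.induction_on with
  | empty => simpa only [macCov_empty, sub_self] using convexOn_const 0 convex_posDef
  | insert k s hk ih =>
    have hlast : ConvexOn ℝ {A : Matrix (Fin N) (Fin N) ℂ | A.PosDef} fun A =>
        logDet (macCov A h q s + q k • outer (h k)) - logDet (macCov A h q s) :=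
      ((convexOn_logDet_add_smul_outer_sub (hq k) (h k)).translate_left
        (∑ i ∈ s, q i • outer (h i))).subset (fun A hA => by
          rw [Set.mem_preimage, add_comm]
          exact posDef_macCov hA hq) convex_posDef
    refine (hlast.add ih).congr fun A _ => ?_
    simp only [Pi.add_apply, macCov_insert hk]
    ring

lemma convexOn_macWsr (ha : Antitone a) (hq : 0 ≤ q) :
    ConvexOn ℝ {A : Matrix (Fin N) (Fin N) ℂ | A.PosDef} fun A => macWsr K h a A q := by
  have hterm := fun i => (convexOn_logDet_macCov_sub (h := h) hq (Finset.range (i + 1))).smul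
    (weight_sub_nonneg ha i)
  refine ⟨convex_posDef, fun A hA B hB x y hx hy hxy => ?_⟩
  simp only [macWsr, smul_eq_mul, Finset.mul_sum, ← Finset.sum_add_distrib]
  exact Finset.sum_le_sum fun i _ => by simpa using (hterm i).2 hA hB hx hy hxy

lemma continuousOn_macWsr {X : Type*} [TopologicalSpace X] {s : Set X}
    {f : X → Matrix (Fin N) (Fin N) ℂ} {g : X → ℕ → ℝ} (hf : ContinuousOn f s)
    (hg : ContinuousOn g s) (hA : ∀ x ∈ s, (f x).PosDef) (hq : ∀ x ∈ s, 0 ≤ g x) :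
    ContinuousOn (fun x => macWsr K h a (f x) (g x)) s := by
  refine continuousOn_finsetSum _ fun i _ => continuousOn_const.mul (ContinuousOn.sub ?_ ?_)
  · refine continuousOn_logDet.comp (hf.add (continuousOn_finsetSum _ fun k _ => ?_))
      fun x hx => posDef_macCov (hA x hx) (hq x hx)
    exact (continuousOn_pi.1 hg k).smul continuousOn_const
  · exact continuousOn_logDet.comp hf hA

lemma sum_trMul_inv_eq_sum_macGrad (r : ℕ → ℝ) :
    ∑ i ∈ Finset.range K, (a i - a (i + 1)) *
        trMul (macCov A h q (Finset.range (i + 1)))⁻¹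
          (∑ k ∈ Finset.range (i + 1), r k • outer (h k)) =
      ∑ k ∈ Finset.range K, r k * macGrad K h a A q k := by
  simp only [macGrad, trMul_sum, trMul_smul, trMul_outer, Finset.mul_sum]
  rw [Finset.sum_comm' (t' := Finset.range K) (s' := fun k => Finset.Ico k K)]
  · exact Finset.sum_congr rfl fun k _ => Finset.sum_congr rfl fun i _ => by ring
  · intro i k
    simp only [Finset.mem_range, Finset.mem_Ico]
    omega

lemma trMul_macNoiseGrad (haK : a K = 0) (B : Matrix (Fin N) (Fin N) ℂ) :
    trMul (macNoiseGrad K h a A q) B = ∑ i ∈ Finset.range K, (a i - a (i + 1)) *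
      (trMul A⁻¹ B - trMul (macCov A h q (Finset.range (i + 1)))⁻¹ B) := by
  simp only [macNoiseGrad, sub_trMul, smul_trMul, sum_trMul, mul_sub, Finset.sum_sub_distrib,
    ← Finset.sum_mul, sum_weight_sub haK]

lemma hasDerivAt_macWsr (haK : a K = 0) (hA : A.PosDef) (hq : 0 ≤ q)
    (B : Matrix (Fin N) (Fin N) ℂ) (r : ℕ → ℝ) :
    HasDerivAt (fun t : ℝ => macWsr K h a (A + t • B) (q + t • r))
      (∑ k ∈ Finset.range K, r k * macGrad K h a A q k - trMul (macNoiseGrad K h a A q) B) 0 := by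
  simp only [macWsr, macCov_add_smul]
  refine (HasDerivAt.fun_sum fun i _ => ((hasDerivAt_logDet (posDef_macCov hA hq) _).sub
    (hasDerivAt_logDet hA B)).const_mul (a i - a (i + 1))).congr_deriv ?_
  rw [← sum_trMul_inv_eq_sum_macGrad, trMul_macNoiseGrad haK, ← Finset.sum_sub_distrib]
  refine Finset.sum_congr rfl fun i _ => ?_
  rw [show macCov B h r (Finset.range (i + 1)) =
    B + ∑ k ∈ Finset.range (i + 1), r k • outer (h k) from rfl, trMul_add]
  ring

lemma trMul_macNoiseGrad_self (haK : a K = 0) (hA : A.PosDef) (hq : 0 ≤ q) :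
    trMul (macNoiseGrad K h a A q) A = ∑ k ∈ Finset.range K, q k * macGrad K h a A q k := by
  rw [← sum_trMul_inv_eq_sum_macGrad, trMul_macNoiseGrad haK]
  refine Finset.sum_congr rfl fun i _ => ?_
  have hcov := trMul_inv_self (posDef_macCov (h := h) (s := Finset.range (i + 1)) hA hq)
  nth_rw 2 [macCov] at hcov
  rw [trMul_add] at hcov
  rw [trMul_inv_self hA, ← hcov]
  ring

lemma sum_one_sub_exp_le_sum_macGrad (ha : Antitone a) (hA : A.PosDef) (hq : 0 ≤ q) :
    ∑ i ∈ Finset.range K, (a i - a (i + 1)) *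
        (1 - Real.exp (-(logDet (macCov A h q (Finset.range (i + 1))) - logDet A))) ≤
      ∑ k ∈ Finset.range K, q k * macGrad K h a A q k := by
  rw [← sum_trMul_inv_eq_sum_macGrad]
  refine Finset.sum_le_sum fun i _ => mul_le_mul_of_nonneg_left ?_ (weight_sub_nonneg ha i)
  refine (one_sub_exp_le_trMul hA (posDef_macCov hA hq) (le_macCov hq)).trans_eq ?_
  rw [macCov, add_sub_cancel_left]

lemma exists_forall_le_sum_mul_one_sub_exp {ι : Type*} {w : ι → ℝ} (hw : 0 ≤ w) (s : Finset ι)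
    {c : ℝ} (hc : 0 < c) :
    ∃ δ > 0, ∀ x : ι → ℝ, 0 ≤ x → c ≤ ∑ i ∈ s, w i * x i →
      δ ≤ ∑ i ∈ s, w i * (1 - Real.exp (-x i)) := by
  classical
  induction s using Finset.induction_on generalizing c with
  | empty => exact ⟨1, one_pos, fun x _ hx => absurd hx (by simpa using hc)⟩
  | insert k s hk ih =>
    obtain ⟨δ, hδ, hs⟩ := ih (half_pos hc)
    have hterm : ∀ x : ι → ℝ, 0 ≤ x → ∀ i, 0 ≤ w i * (1 - Real.exp (-x i)) := fun x hx i =>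
      mul_nonneg (hw i) (sub_nonneg.2 (Real.exp_le_one_iff.2 (neg_nonpos.2 (hx i))))
    rcases (show 0 ≤ w k from hw k).eq_or_lt with hwk | hwk
    · refine ⟨δ, hδ, fun x hx hcx => ?_⟩
      rw [Finset.sum_insert hk, ← hwk, zero_mul, zero_add] at hcx ⊢
      exact hs x hx (by linarith)
    · have hexp : Real.exp (-(c / 2 / w k)) < 1 := Real.exp_lt_one_iff.2 (by
        rw [neg_lt_zero]
        positivity)
      refine ⟨min δ (w k * (1 - Real.exp (-(c / 2 / w k)))),
        lt_min hδ (mul_pos hwk (sub_pos.2 hexp)), fun x hx hcx => ?_⟩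
      rw [Finset.sum_insert hk] at hcx ⊢
      rcases le_total (c / 2) (w k * x k) with hk' | hk'
      · refine (min_le_right _ _).trans (le_add_of_le_of_nonneg ?_
          (Finset.sum_nonneg fun i _ => hterm x hx i))
        have := (div_le_iff₀' hwk).2 hk'
        gcongr
      · exact (min_le_left _ _).trans (le_add_of_nonneg_of_le (hterm x hx k)
          (hs x hx (by linarith)))

/-- A lower bound for the price of power, by concavity of the rate along scalings of the powers. -/
lemma exists_forall_le_sum_macGrad (K : ℕ) (h : ℕ → Fin N → ℂ) (ha : Antitone a) {c : ℝ}
    (hc : 0 < c) :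
    ∃ δ > 0, ∀ (A : Matrix (Fin N) (Fin N) ℂ) (q : ℕ → ℝ), A.PosDef → 0 ≤ q →
      c ≤ macWsr K h a A q → δ ≤ ∑ k ∈ Finset.range K, q k * macGrad K h a A q k := by
  obtain ⟨δ, hδ, hle⟩ :=
    exists_forall_le_sum_mul_one_sub_exp (weight_sub_nonneg ha) (Finset.range K) hc
  refine ⟨δ, hδ, fun A q hA hq hcw => (hle _ (fun i => ?_) hcw).trans
    (sum_one_sub_exp_le_sum_macGrad ha hA hq)⟩
  exact sub_nonneg.2 (logDet_mono hA (posDef_macCov hA hq) (le_macCov hq))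

end MacWsr

/-! ### From the multiple access channel to the broadcast channel -/

/-- The signal covariance of user `i` of the broadcast channel, up to scaling, that corresponds to
the multiple access powers `q`. -/
def bcCov (h : ℕ → Fin N → ℂ) (a : ℕ → ℝ) (A : Matrix (Fin N) (Fin N) ℂ) (q : ℕ → ℝ) (i : ℕ) :
    Matrix (Fin N) (Fin N) ℂ :=
  a i • ((macCov A h q (Finset.range i))⁻¹ - (macCov A h q (Finset.range (i + 1)))⁻¹)

section BcCov

variable {K : ℕ} {h : ℕ → Fin N → ℂ} {a : ℕ → ℝ} {A : Matrix (Fin N) (Fin N) ℂ} {q : ℕ → ℝ}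
  {i : ℕ} {κ : ℝ}

lemma posSemidef_bcCov (ha : 0 ≤ a i) (hA : A.PosDef) (hq : 0 ≤ q) :
    (bcCov h a A q i).PosSemidef :=
  (Matrix.le_iff.1 (inv_le_inv_of_posDef (posDef_macCov hA hq) (posDef_macCov hA hq)
    (macCov_mono hq le_rfl (Finset.range_subset_range.2 i.le_succ)))).smul ha

lemma bcTail_bcCov (haK : a K = 0) (hi : i ≤ K) :
    bcTail K (bcCov h a A q) i = a i • (macCov A h q (Finset.range i))⁻¹ -
      ∑ k ∈ Finset.Ico i K, (a k - a (k + 1)) • (macCov A h q (Finset.range (k + 1)))⁻¹ := by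
  suffices hsum : ∀ m, i ≤ m → ∑ k ∈ Finset.Ico i m, bcCov h a A q k =
      a i • (macCov A h q (Finset.range i))⁻¹ -
        ∑ k ∈ Finset.Ico i m, (a k - a (k + 1)) • (macCov A h q (Finset.range (k + 1)))⁻¹ -
        a m • (macCov A h q (Finset.range m))⁻¹ by
    rw [bcTail, hsum K hi, haK, zero_smul, sub_zero]
  intro m him
  induction m, him using Nat.le_induction with
  | base => simp
  | succ m him ih =>
    rw [Finset.sum_Ico_succ_top him, ih, Finset.sum_Ico_succ_top him, bcCov]
    module

lemma sum_bcCov (haK : a K = 0) :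
    ∑ i ∈ Finset.range K, bcCov h a A q i = macNoiseGrad K h a A q := by
  have htail := bcTail_bcCov (h := h) (A := A) (q := q) haK K.zero_le
  rwa [bcTail, Nat.Ico_zero_eq_range, Finset.range_zero, macCov_empty] at htail

lemma quad_bcTail_succ_bcCov (haK : a K = 0) (hi : i < K) :
    quad (bcTail K (bcCov h a A q) (i + 1)) (h i) =
      a i * quad (macCov A h q (Finset.range (i + 1)))⁻¹ (h i) - macGrad K h a A q i := by
  rw [bcTail_bcCov haK hi, macGrad, Finset.sum_eq_sum_Ico_succ_bot hi]
  simp only [quad_sub, quad_smul, quad_sum]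
  ring

lemma quad_bcCov (hA : A.PosDef) (hq : 0 ≤ q) :
    quad (bcCov h a A q i) (h i) = a i * quad (macCov A h q (Finset.range (i + 1)))⁻¹ (h i) *
      (q i * quad (macCov A h q (Finset.range i))⁻¹ (h i)) := by
  have hinv := quad_inv_add_smul_outer (posDef_macCov (h := h) (s := Finset.range i) hA hq) (hq i)
    (h i)
  rw [← macCov_insert Finset.notMem_range_self, ← Finset.range_add_one] at hinv
  rw [bcCov, quad_smul, quad_sub]
  linear_combination -(a i) * hinv

lemma bcRate_inv_smul (hκ : 0 < κ) {S : ℕ → Matrix (Fin N) (Fin N) ℂ} (hi : i < K) :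
    bcRate K h (κ⁻¹ • S) i = Real.log ((κ + quad (bcTail K S (i + 1)) (h i) + quad (S i) (h i)) /
      (κ + quad (bcTail K S (i + 1)) (h i))) := by
  have htail : ∀ m, bcTail K (κ⁻¹ • S) m = κ⁻¹ • bcTail K S m := fun m => by
    simp only [bcTail, Pi.smul_apply, Finset.smul_sum]
  rw [bcRate, htail, htail, bcTail_eq_add hi, quad_smul, quad_smul, quad_add]
  congr 1
  field_simp
  ring

lemma logDet_macCov_sub_le_bcRate (ha : Antitone a) (haK : a K = 0) (hA : A.PosDef) (hq : 0 ≤ q)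
    (hκ : 0 < κ) (hi : i < K) (hgrad : 0 < q i → κ ≤ macGrad K h a A q i) :
    logDet (macCov A h q (Finset.range (i + 1))) - logDet (macCov A h q (Finset.range i)) ≤
      bcRate K h (κ⁻¹ • bcCov h a A q) i := by
  have ha_nonneg : ∀ k ≤ K, 0 ≤ a k := fun k hk => haK ▸ ha hk
  have hcov : (macCov A h q (Finset.range i)).PosDef := posDef_macCov hA hq
  have hsignal := quad_bcCov (h := h) (a := a) (i := i) hA hq
  have htail := quad_bcTail_succ_bcCov (h := h) (A := A) (q := q) haK hi
  have htail_nonneg : 0 ≤ quad (bcTail K (bcCov h a A q) (i + 1)) (h i) :=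
    quad_nonneg (Matrix.posSemidef_sum _ fun k hk =>
      posSemidef_bcCov (ha_nonneg k (Finset.mem_Ico.1 hk).2.le) hA hq) _
  have hsnr : 0 ≤ q i * quad (macCov A h q (Finset.range i))⁻¹ (h i) :=
    mul_nonneg (hq i) (quad_nonneg hcov.inv.posSemidef _)
  rw [bcRate_inv_smul hκ hi, Finset.range_add_one, macCov_insert Finset.notMem_range_self,
    logDet_add_smul_outer hcov (hq i), add_sub_cancel_left]
  refine Real.log_le_log (by linarith) ?_
  rw [le_div_iff₀ (by linarith)]
  rcases (hq i).eq_or_lt with hqi | hqi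
  · rw [Pi.zero_apply] at hqi
    rw [hsignal, ← hqi]
    linarith
  · have hnoise : κ + quad (bcTail K (bcCov h a A q) (i + 1)) (h i) ≤
        a i * quad (macCov A h q (Finset.range (i + 1)))⁻¹ (h i) := by
      linarith [hgrad hqi]
    linarith [mul_le_mul_of_nonneg_right hnoise hsnr]

lemma macWsr_le_sum_bcRate (ha : Antitone a) (haK : a K = 0) (hA : A.PosDef) (hq : 0 ≤ q)
    (hκ : 0 < κ) (hgrad : ∀ i < K, 0 < q i → κ ≤ macGrad K h a A q i) :
    macWsr K h a A q ≤ ∑ i ∈ Finset.range K, a i * bcRate K h (κ⁻¹ • bcCov h a A q) i := by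
  rw [macWsr_eq_sum_mul_sub haK]
  refine Finset.sum_le_sum fun i hi => mul_le_mul_of_nonneg_left ?_ ?_
  · exact logDet_macCov_sub_le_bcRate ha haK hA hq hκ (Finset.mem_range.1 hi)
      (hgrad i (Finset.mem_range.1 hi))
  · rw [← haK]
    exact ha (Finset.mem_range.1 hi).le

end BcCov

/-! ### Saddle points over the multipliers -/

/-- The noise covariance of the dual channel for the multipliers `y` of the linear power
constraints with matrices `W`. -/
def linCov (W : J → Matrix (Fin N) (Fin N) ℂ) : (J → ℝ) →ₗ[ℝ] Matrix (Fin N) (Fin N) ℂ :=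
  Fintype.linearCombination ℝ W

/-- The multipliers `y` with a nondegenerate noise covariance, normalised so that the power budget
`∑ j, y j * e j` of the dual channel is one. -/
def dualSlice (W : J → Matrix (Fin N) (Fin N) ℂ) (e : J → ℝ) : Set (J → ℝ) :=
  {y | 0 ≤ y ∧ ∑ j, y j * e j = 1 ∧ (linCov W y).PosDef}

/-- A convex function whose sublevel sets in `dualSlice W e` are compact. -/
def barrier (W : J → Matrix (Fin N) (Fin N) ℂ) (y : J → ℝ) : ℝ :=
  ∑ j, y j - logDet (linCov W y)

/-- The weighted sum-rate of the dual channel, regularised in the multipliers. -/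
def regWsr (K : ℕ) (h : ℕ → Fin N → ℂ) (a : ℕ → ℝ) (W : J → Matrix (Fin N) (Fin N) ℂ) (ε : ℝ)
    (y : J → ℝ) (p : ℕ → ℝ) : ℝ :=
  macWsr K h a (linCov W y) p + ε * barrier W y

section Saddle

variable {K : ℕ} {h : ℕ → Fin N → ℂ} {a : ℕ → ℝ} {W : J → Matrix (Fin N) (Fin N) ℂ} {e : J → ℝ}
  {ε : ℝ}

lemma linCov_apply (y : J → ℝ) : linCov W y = ∑ j, y j • W j :=
  Fintype.linearCombination_apply ℝ W y

lemma continuous_linCov (W : J → Matrix (Fin N) (Fin N) ℂ) : Continuous (linCov W) := by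
  simp only [funext linCov_apply]
  fun_prop

lemma continuousOn_barrier : ContinuousOn (barrier W) {y | (linCov W y).PosDef} :=
  (by fun_prop : Continuous fun y : J → ℝ => ∑ j, y j).continuousOn.sub <|
    continuousOn_logDet.comp (continuous_linCov W).continuousOn fun _ hy => hy

lemma convexOn_barrier : ConvexOn ℝ {y | (linCov W y).PosDef} (barrier W) := by
  refine ConvexOn.sub ?_ (concaveOn_logDet.comp_linearMap (linCov W))
  refine ⟨convex_posDef.linear_preimage (linCov W), fun x _ y _ s t _ _ _ => le_of_eq ?_⟩
  simp only [Pi.add_apply, Pi.smul_apply, Finset.sum_add_distrib, Finset.smul_sum]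

lemma convex_dualSlice (W : J → Matrix (Fin N) (Fin N) ℂ) (e : J → ℝ) :
    Convex ℝ (dualSlice W e) := by
  refine (convex_Ici 0).inter (Convex.inter ?_ (convex_posDef.linear_preimage (linCov W)))
  have hbudget := (convex_singleton (1 : ℝ)).linear_preimage (Fintype.linearCombination ℝ e)
  simp only [Set.preimage, Set.mem_singleton_iff, Fintype.linearCombination_apply, smul_eq_mul]
    at hbudget
  exact hbudget

lemma exists_sum_half_sub_le_barrier (W : J → Matrix (Fin N) (Fin N) ℂ) :
    ∃ C : ℝ, ∀ y : J → ℝ, 0 ≤ y → (linCov W y).PosDef → (∑ j, y j) / 2 - C ≤ barrier W y := by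
  obtain ⟨c, hc⟩ : ∃ c : ℝ, ∀ j, trMul 1 (W j) ≤ c :=
    ⟨∑ j, |trMul 1 (W j)|, fun j => (le_abs_self _).trans
      (Finset.single_le_sum (fun i _ => abs_nonneg (trMul 1 (W i))) (Finset.mem_univ j))⟩
  set b := 2 * max c 1 with hb
  have hb_pos : 0 < b := by positivity
  have hB : (b • (1 : Matrix (Fin N) (Fin N) ℂ)).PosDef := Matrix.PosDef.one.smul hb_pos
  have hBinv : (b • (1 : Matrix (Fin N) (Fin N) ℂ))⁻¹ = b⁻¹ • 1 :=
    Matrix.inv_eq_right_inv (by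
      rw [smul_mul_smul_comm, mul_one, mul_inv_cancel₀ hb_pos.ne', one_smul])
  refine ⟨logDet (b • (1 : Matrix (Fin N) (Fin N) ℂ)), fun y hy hA => ?_⟩
  have htrace : trMul 1 (linCov W y) ≤ max c 1 * ∑ j, y j := by
    simp only [linCov_apply, trMul_sum, trMul_smul, mul_comm (max c 1), Finset.sum_mul]
    exact Finset.sum_le_sum fun j _ =>
      mul_le_mul_of_nonneg_left ((hc j).trans (le_max_left _ _)) (hy j)
  have hscaled : trMul (b • (1 : Matrix (Fin N) (Fin N) ℂ))⁻¹ (linCov W y) ≤ (∑ j, y j) / 2 := by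
    rw [hBinv, smul_trMul, inv_mul_le_iff₀ hb_pos, hb]
    linarith
  have htangent := logDet_sub_le hB hA
  rw [trMul_sub] at htangent
  have := trMul_nonneg hB.inv.posSemidef hB.posSemidef
  rw [barrier]
  linarith

lemma isCompact_dualSlice_barrier_le (W : J → Matrix (Fin N) (Fin N) ℂ) (e : J → ℝ) (b : ℝ) :
    IsCompact {y | y ∈ dualSlice W e ∧ barrier W y ≤ b} := by
  have hdet : {y | y ∈ dualSlice W e ∧ barrier W y ≤ b} =
      Set.Ici 0 ∩ ({y | ∑ j, y j * e j = 1} ∩ ({y | (linCov W y).PosSemidef} ∩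
        {y | Real.exp (∑ j, y j - b) ≤ (linCov W y).det.re})) := by
    ext y
    have hlog (hA : (linCov W y).PosDef) :
        barrier W y ≤ b ↔ Real.exp (∑ j, y j - b) ≤ (linCov W y).det.re := by
      rw [barrier, logDet, ← Real.le_log_iff_exp_le (det_re_pos hA), sub_le_comm]
    constructor
    · rintro ⟨⟨hy, hbudget, hA⟩, hle⟩
      exact ⟨hy, hbudget, hA.posSemidef, (hlog hA).1 hle⟩
    · rintro ⟨hy, hbudget, hA, hle⟩
      have hdet_ne : (linCov W y).det ≠ 0 := fun h0 => by
        have := (Real.exp_pos (∑ j, y j - b)).trans_le hle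
        simp [h0] at this
      have hA' := hA.posDef_iff_det_ne_zero.2 hdet_ne
      exact ⟨⟨hy, hbudget, hA'⟩, (hlog hA').2 hle⟩
  have hclosed : IsClosed {y | y ∈ dualSlice W e ∧ barrier W y ≤ b} := by
    have hcov := continuous_linCov W
    rw [hdet]
    exact isClosed_Ici.inter ((isClosed_eq (by fun_prop) continuous_const).inter
      ((isClosed_posSemidef.preimage hcov).inter (isClosed_le (by fun_prop)
        (Complex.continuous_re.comp (Continuous.matrix_det hcov)))))
  obtain ⟨C, hC⟩ := exists_sum_half_sub_le_barrier W
  refine (isCompact_Icc (a := 0) (b := fun _ => 2 * (b + C))).of_isClosed_subset hclosed ?_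
  rintro y ⟨⟨hy, -, hA⟩, hle⟩
  refine ⟨hy, fun j => ?_⟩
  have := Finset.single_le_sum (fun i _ => hy i) (Finset.mem_univ j)
  have := hC y hy hA
  linarith

lemma exists_isMaxOn_macWsr (hK : 0 < K) {A : Matrix (Fin N) (Fin N) ℂ} (hA : A.PosDef) :
    ∃ p ∈ powerSimplex K, IsMaxOn (macWsr K h a A) (powerSimplex K) p :=
  (isCompact_powerSimplex K).exists_isMaxOn ⟨_, single_mem_powerSimplex hK⟩
    (continuousOn_macWsr continuousOn_const continuousOn_id (fun _ _ => hA) fun _ hp => hp.1)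

lemma exists_isSaddlePointOn_barrier_le (hK : 0 < K) (ha : Antitone a) (hε : 0 < ε) {b : ℝ}
    (hb : {y | y ∈ dualSlice W e ∧ barrier W y ≤ b}.Nonempty) :
    ∃ y ∈ {y | y ∈ dualSlice W e ∧ barrier W y ≤ b}, ∃ p ∈ powerSimplex K,
      IsSaddlePointOn {y | y ∈ dualSlice W e ∧ barrier W y ≤ b} (powerSimplex K)
        (regWsr K h a W ε) y p := by
  set X := {y | y ∈ dualSlice W e ∧ barrier W y ≤ b}
  have hXpos : X ⊆ {y | (linCov W y).PosDef} := fun y hy => hy.1.2.2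
  have hslice : dualSlice W e ⊆ {y | (linCov W y).PosDef} := fun y hy => hy.2.2
  have hconv : Convex ℝ X := (convexOn_barrier.subset hslice (convex_dualSlice W e)).convex_le b
  refine Sion.exists_isSaddlePointOn hb hconv (isCompact_dualSlice_barrier_le W e b)
    (fun p hp => ?_) (fun p hp => ?_) (convex_powerSimplex K) ⟨_, single_mem_powerSimplex hK⟩
    (isCompact_powerSimplex K) (fun y hy => ?_) (fun y hy => ?_)
  · refine ContinuousOn.lowerSemicontinuousOn (ContinuousOn.add ?_
      ((continuousOn_barrier.mono hXpos).const_mul ε))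
    exact continuousOn_macWsr (continuous_linCov W).continuousOn continuousOn_const
      (fun y hy => hXpos hy) fun _ _ => hp.1
  · refine ConvexOn.quasiconvexOn (ConvexOn.add ?_
      ((convexOn_barrier.subset hXpos hconv).smul hε.le))
    exact ((convexOn_macWsr ha hp.1).comp_linearMap (linCov W)).subset hXpos hconv
  · refine ContinuousOn.upperSemicontinuousOn (ContinuousOn.add ?_ continuousOn_const)
    exact continuousOn_macWsr continuousOn_const continuousOn_id (fun _ _ => hXpos hy)
      fun p hp => hp.1
  · exact (((concaveOn_macWsr ha (hXpos hy)).subset (fun p hp => hp.1)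
      (convex_powerSimplex K)).add_const _).quasiconcaveOn

lemma exists_isSaddlePointOn (hK : 0 < K) (ha : Antitone a) (hne : (dualSlice W e).Nonempty)
    (hε : 0 < ε) :
    ∃ y ∈ dualSlice W e, ∃ p ∈ powerSimplex K,
      IsSaddlePointOn (dualSlice W e) (powerSimplex K) (regWsr K h a W ε) y p := by
  obtain ⟨y₀, hy₀⟩ := hne
  obtain ⟨p₀, hp₀, hmax⟩ := exists_isMaxOn_macWsr (h := h) (a := a) hK hy₀.2.2
  set b := ε⁻¹ * regWsr K h a W ε y₀ p₀
  have hεb : ε * b = regWsr K h a W ε y₀ p₀ := mul_inv_cancel_left₀ hε.ne' _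
  have hy₀b : barrier W y₀ ≤ b := by
    refine le_of_mul_le_mul_left ?_ hε
    rw [hεb, regWsr]
    exact le_add_of_nonneg_left (macWsr_nonneg ha hy₀.2.2 hp₀.1)
  obtain ⟨y, hy, p, hp, hsaddle⟩ :=
    exists_isSaddlePointOn_barrier_le (h := h) hK ha hε ⟨y₀, hy₀, hy₀b⟩
  refine ⟨y, hy.1, p, hp, fun y' hy' p' hp' => ?_⟩
  rcases le_or_gt (barrier W y') b with hle | hlt
  · exact hsaddle y' ⟨hy', hle⟩ p' hp'
  -- outside the sublevel set the barrier alone exceeds the value at `y₀`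
  calc regWsr K h a W ε y p' ≤ regWsr K h a W ε y₀ p := hsaddle y₀ ⟨hy₀, hy₀b⟩ p' hp'
    _ ≤ regWsr K h a W ε y₀ p₀ := add_le_add_left (hmax hp) _
    _ = ε * b := hεb.symm
    _ ≤ ε * barrier W y' := by gcongr
    _ ≤ regWsr K h a W ε y' p := le_add_of_nonneg_left (macWsr_nonneg ha hy'.2.2 hp.1)

end Saddle

/-! ### Stationarity at a saddle point -/

lemma nonneg_of_hasDerivAt_of_eventually_le {f : ℝ → ℝ} {f' : ℝ} (hf : HasDerivAt f f' 0)
    (hle : ∀ᶠ t in nhdsWithin 0 (Set.Ioi 0), f 0 ≤ f t) : 0 ≤ f' := by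
  refine ge_of_tendsto hf.tendsto_slope_zero_right ?_
  filter_upwards [hle, self_mem_nhdsWithin] with t ht ht_pos
  rw [zero_add]
  exact mul_nonneg (inv_nonneg.2 (Set.mem_Ioi.1 ht_pos).le) (sub_nonneg.2 ht)

section Stationarity

variable {K : ℕ} {h : ℕ → Fin N → ℂ} {a : ℕ → ℝ} {A : Matrix (Fin N) (Fin N) ℂ} {p : ℕ → ℝ}

lemma sum_mul_macGrad_le_of_isMaxOn (haK : a K = 0) (hA : A.PosDef) (hp : p ∈ powerSimplex K)
    (hmax : IsMaxOn (macWsr K h a A) (powerSimplex K) p) {r : ℕ → ℝ} (hr : r ∈ powerSimplex K) :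
    ∑ k ∈ Finset.range K, r k * macGrad K h a A p k ≤
      ∑ k ∈ Finset.range K, p k * macGrad K h a A p k := by
  have hderiv := (hasDerivAt_macWsr (h := h) haK hA hp.1 0 (r - p)).neg
  have hnonneg := nonneg_of_hasDerivAt_of_eventually_le hderiv (by
    filter_upwards [Ioo_mem_nhdsGT one_pos] with t ht
    simp only [Pi.neg_apply, smul_zero, add_zero, zero_smul]
    exact neg_le_neg (hmax ((convex_powerSimplex K).add_smul_sub_mem hp hr ⟨ht.1.le, ht.2.le⟩)))
  simp only [trMul, mul_zero, Matrix.trace_zero, Complex.zero_re, sub_zero, Pi.sub_apply, sub_mul,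
    Finset.sum_sub_distrib] at hnonneg
  linarith

lemma macGrad_le_of_isMaxOn (haK : a K = 0) (hA : A.PosDef) (hp : p ∈ powerSimplex K)
    (hmax : IsMaxOn (macWsr K h a A) (powerSimplex K) p) {l : ℕ} (hl : l < K) :
    macGrad K h a A p l ≤ ∑ k ∈ Finset.range K, p k * macGrad K h a A p k := by
  simpa [Pi.single_apply, hl] using
    sum_mul_macGrad_le_of_isMaxOn haK hA hp hmax (single_mem_powerSimplex hl)

lemma macGrad_eq_of_isMaxOn (haK : a K = 0) (hA : A.PosDef) (hp : p ∈ powerSimplex K)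
    (hmax : IsMaxOn (macWsr K h a A) (powerSimplex K) p) {l : ℕ} (hl : l < K) (hpl : 0 < p l) :
    macGrad K h a A p l = ∑ k ∈ Finset.range K, p k * macGrad K h a A p k := by
  set κ := ∑ k ∈ Finset.range K, p k * macGrad K h a A p k with hκ
  have hslack : ∑ k ∈ Finset.range K, p k * (κ - macGrad K h a A p k) = 0 := by
    simp only [mul_sub, Finset.sum_sub_distrib, ← Finset.sum_mul, hp.2.2, one_mul, ← hκ, sub_self]
  have hzero := (Finset.sum_eq_zero_iff_of_nonneg fun k hk => mul_nonneg (hp.1 k) (sub_nonneg.2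
    (macGrad_le_of_isMaxOn haK hA hp hmax (Finset.mem_range.1 hk)))).1 hslack l
    (Finset.mem_range.2 hl)
  exact (sub_eq_zero.1 ((mul_eq_zero.1 hzero).resolve_left hpl.ne')).symm

end Stationarity

section NearOptimal

variable {K : ℕ} {h : ℕ → Fin N → ℂ} {a : ℕ → ℝ} {W : J → Matrix (Fin N) (Fin N) ℂ} {e : J → ℝ}
  {ε : ℝ} {y : J → ℝ} {p : ℕ → ℝ}

lemma linCov_single [DecidableEq J] (j : J) : linCov W (Pi.single j 1) = W j := by
  rw [linCov, Fintype.linearCombination_apply_single, one_smul]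

lemma isHermitian_linCov (hW : ∀ j, (W j).IsHermitian) (y : J → ℝ) : (linCov W y).IsHermitian := by
  rw [linCov_apply]
  exact isSelfAdjoint_sum _ fun j _ => IsSelfAdjoint.smul (IsSelfAdjoint.all (y j)) (hW j)

/-- The direction keeps the power budget equal to one. -/
lemma eventually_add_smul_single_sub_mem_dualSlice [DecidableEq J] (hW : ∀ j, (W j).IsHermitian)
    (hy : y ∈ dualSlice W e) (j : J) :
    ∀ᶠ t : ℝ in nhdsWithin 0 (Set.Ioi 0), y + t • (Pi.single j 1 - e j • y) ∈ dualSlice W e := by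
  have hpos : ∀ᶠ t : ℝ in nhdsWithin 0 (Set.Ioi 0), t * e j < 1 :=
    ((by fun_prop : Continuous fun t : ℝ => t * e j).continuousAt.eventually_lt_const
      (by simp)).filter_mono nhdsWithin_le_nhds
  filter_upwards [hpos, self_mem_nhdsWithin, (eventually_posDef_add_smul hy.2.2
    (isHermitian_linCov hW (Pi.single j 1 - e j • y))).filter_mono nhdsWithin_le_nhds]
    with t hte ht hA
  refine ⟨?_, ?_, by rwa [map_add, map_smul]⟩
  · have hsplit : y + t • (Pi.single j 1 - e j • y) = (1 - t * e j) • y + t • Pi.single j 1 := by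
      module
    rw [hsplit]
    exact add_nonneg (smul_nonneg (sub_nonneg.2 hte.le) hy.1)
      (smul_nonneg (Set.mem_Ioi.1 ht).le (Pi.single_nonneg.2 zero_le_one))
  · have hbudget := hy.2.1
    simp only [Pi.add_apply, Pi.smul_apply, Pi.sub_apply, smul_eq_mul, add_mul, mul_assoc, sub_mul,
      Finset.sum_add_distrib, Finset.sum_sub_distrib, ← Finset.mul_sum, hbudget, Pi.single_apply,
      ite_mul, one_mul, zero_mul, Finset.sum_ite_eq', Finset.mem_univ, if_true, mul_one, sub_self,
      mul_zero, add_zero]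

lemma hasDerivAt_regWsr (haK : a K = 0) (hA : (linCov W y).PosDef) (hp : 0 ≤ p) (ε : ℝ)
    (d : J → ℝ) :
    HasDerivAt (fun t : ℝ => regWsr K h a W ε (y + t • d) p)
      (ε * ∑ j, d j - trMul (macNoiseGrad K h a (linCov W y) p + ε • (linCov W y)⁻¹)
        (linCov W d)) 0 := by
  have hwsr := hasDerivAt_macWsr (h := h) haK hA hp (linCov W d) 0
  have hsum : HasDerivAt (fun t : ℝ => ∑ j, (y j + t * d j)) (∑ j, d j) 0 :=
    HasDerivAt.fun_sum fun j _ => by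
      simpa using ((hasDerivAt_id (0 : ℝ)).mul_const (d j)).const_add (y j)
  have hreg := hwsr.add ((hsum.sub (hasDerivAt_logDet hA (linCov W d))).const_mul ε)
  simp only [smul_zero, add_zero, Pi.zero_apply, zero_mul, Finset.sum_const_zero] at hreg
  simp only [regWsr, barrier, map_add, map_smul, Pi.add_apply, Pi.smul_apply, smul_eq_mul]
  refine hreg.congr_deriv ?_
  rw [add_trMul, smul_trMul]
  ring

lemma trMul_macNoiseGrad_le_of_isMinOn (haK : a K = 0) (hW : ∀ j, (W j).IsHermitian)
    (hy : y ∈ dualSlice W e) (hp : 0 ≤ p)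
    (hmin : IsMinOn (fun y => regWsr K h a W ε y p) (dualSlice W e) y) (j : J) :
    trMul (macNoiseGrad K h a (linCov W y) p + ε • (linCov W y)⁻¹) (W j) ≤
      e j * ∑ k ∈ Finset.range K, p k * macGrad K h a (linCov W y) p k +
        ε * (e j * N + (1 - e j * ∑ i, y i)) := by
  classical
  have hderiv := hasDerivAt_regWsr (h := h) haK hy.2.2 hp ε (Pi.single j 1 - e j • y)
  have hnonneg := nonneg_of_hasDerivAt_of_eventually_le hderiv (by
    filter_upwards [eventually_add_smul_single_sub_mem_dualSlice hW hy j] with t ht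
    simpa using hmin ht)
  rw [map_sub, map_smul, linCov_single, trMul_sub, trMul_smul, add_trMul _ _ (linCov W y),
    trMul_macNoiseGrad_self haK hy.2.2 hp, smul_trMul, trMul_inv_self hy.2.2] at hnonneg
  simp only [Pi.sub_apply, Pi.smul_apply, smul_eq_mul, Finset.sum_sub_distrib, ← Finset.mul_sum,
    Finset.sum_pi_single', Finset.mem_univ, if_true] at hnonneg
  linarith

/-- The signal covariances of users `0, …, K - 1` (extended by zero) and the energy covariances
whose sum `Q` satisfies the linear constraints `Tr (Q W j) ≤ e j`. -/
def bcFeasible {ι : Type*} (K : ℕ) (W : ι → Matrix (Fin N) (Fin N) ℂ) (e : ι → ℝ) :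
    Set ((ℕ → Matrix (Fin N) (Fin N) ℂ) × Matrix (Fin N) (Fin N) ℂ) :=
  {x | (∀ k, (x.1 k).PosSemidef) ∧ (∀ k, K ≤ k → x.1 k = 0) ∧ x.2.PosSemidef ∧
    ∀ j, trMul (∑ k ∈ Finset.range K, x.1 k + x.2) (W j) ≤ e j}

lemma exists_bc_of_isSaddlePointOn (ha : Antitone a) (haK : ∀ k, K ≤ k → a k = 0)
    (hW : ∀ j, (W j).IsHermitian) (hε : 0 ≤ ε) (hy : y ∈ dualSlice W e) (hp : p ∈ powerSimplex K)
    (hsaddle : IsSaddlePointOn (dualSlice W e) (powerSimplex K) (regWsr K h a W ε) y p) {κ : ℝ}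
    (hκ : ∑ k ∈ Finset.range K, p k * macGrad K h a (linCov W y) p k = κ) (hκ_pos : 0 < κ) :
    ∃ x ∈ bcFeasible K W (fun j => e j + κ⁻¹ * (ε * (e j * N + (1 - e j * ∑ i, y i)))),
      macWsr K h a (linCov W y) p ≤ ∑ i ∈ Finset.range K, a i * bcRate K h x.1 i := by
  have hmax : IsMaxOn (macWsr K h a (linCov W y)) (powerSimplex K) p := fun r hr =>
    le_of_add_le_add_right (hsaddle y hy r hr)
  have hmin : IsMinOn (fun y => regWsr K h a W ε y p) (dualSlice W e) y := fun x hx =>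
    hsaddle x hx p hp
  refine ⟨(κ⁻¹ • bcCov h a (linCov W y) p, κ⁻¹ • ε • (linCov W y)⁻¹),
    ⟨fun k => ?_, fun k hk => ?_, ?_, fun j => ?_⟩, ?_⟩
  · have hak : 0 ≤ a k := haK _ (le_max_right k K) ▸ ha (le_max_left k K)
    exact (posSemidef_bcCov hak hy.2.2 hp.1).smul (inv_nonneg.2 hκ_pos.le)
  · simp only [Pi.smul_apply, bcCov, haK k hk, zero_smul, smul_zero]
  · exact (hy.2.2.inv.posSemidef.smul hε).smul (inv_nonneg.2 hκ_pos.le)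
  · have hstat := trMul_macNoiseGrad_le_of_isMinOn (haK K le_rfl) hW hy hp.1 hmin j
    simp only [Pi.smul_apply, ← Finset.smul_sum, sum_bcCov (haK K le_rfl)]
    rw [← smul_add, smul_trMul, inv_mul_le_iff₀ hκ_pos, mul_add, mul_inv_cancel_left₀ hκ_pos.ne',
      mul_comm κ, ← hκ]
    exact hstat
  · exact macWsr_le_sum_bcRate ha (haK K le_rfl) hy.2.2 hp.1 hκ_pos fun i hi hpi =>
      (hκ.symm.trans (macGrad_eq_of_isMaxOn (haK K le_rfl) hy.2.2 hp hmax hi hpi).symm).le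

/-- The regularised saddle value exceeds the minimax value by at most the barrier at a nearly
optimal multiplier, so that the barrier term at the saddle point vanishes with `ε`. -/
lemma exists_isSaddlePointOn_mul_sum_le (hK : 0 < K) (ha : Antitone a)
    (hne : (dualSlice W e).Nonempty) {η : ℝ} (hη : 0 < η) :
    ∃ ε > 0, ε ≤ η ∧ ∃ y ∈ dualSlice W e, ∃ p ∈ powerSimplex K, ε * ∑ j, y j ≤ η ∧
      IsSaddlePointOn (dualSlice W e) (powerSimplex K) (regWsr K h a W ε) y p := by
  set V := {v | ∃ y ∈ dualSlice W e, ∀ p ∈ powerSimplex K, macWsr K h a (linCov W y) p ≤ v}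
  have hVne : V.Nonempty := by
    obtain ⟨y, hy⟩ := hne
    obtain ⟨p, -, hmax⟩ := exists_isMaxOn_macWsr (h := h) (a := a) hK hy.2.2
    exact ⟨_, y, hy, fun _ hr => hmax hr⟩
  have hVbdd : BddBelow V := ⟨0, by
    rintro v ⟨y, hy, hv⟩
    have hp := single_mem_powerSimplex hK
    exact (macWsr_nonneg ha hy.2.2 hp.1).trans (hv _ hp)⟩
  obtain ⟨v, ⟨y₀, hy₀, hv⟩, hvlt⟩ :=
    exists_lt_of_csInf_lt hVne (lt_add_of_pos_right (sInf V) (div_pos hη four_pos))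
  obtain ⟨C, hC⟩ := exists_sum_half_sub_le_barrier W
  set D := |barrier W y₀| + |C| + 1
  have hD_pos : 0 < D := by positivity
  set ε := min η (η / 4 / D)
  have hε_pos : 0 < ε := lt_min hη (by positivity)
  have hεD : ε * D ≤ η / 4 := (le_div_iff₀ hD_pos).1 (min_le_right _ _)
  obtain ⟨y, hy, p, hp, hsaddle⟩ := exists_isSaddlePointOn (h := h) hK ha hne hε_pos
  refine ⟨ε, hε_pos, min_le_left _ _, y, hy, p, hp, ?_, hsaddle⟩
  have hvalue : sInf V ≤ macWsr K h a (linCov W y) p := csInf_le hVbdd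
    ⟨y, hy, fun r hr => le_of_add_le_add_right (hsaddle y hy r hr)⟩
  have hsum := mul_le_mul_of_nonneg_left (hC y hy.1 hy.2.2) hε_pos.le
  have hcompare : macWsr K h a (linCov W y) p + ε * barrier W y ≤ v + ε * barrier W y₀ :=
    (hsaddle y₀ hy₀ p hp).trans (add_le_add_left (hv p hp) _)
  have hbound : ε * (barrier W y₀ + C) ≤ ε * D := by
    gcongr
    linarith [le_abs_self (barrier W y₀), le_abs_self C]
  linarith

lemma mul_add_one_sub_mul_le {x E ε η s n : ℝ} (hε : 0 ≤ ε) (hεη : ε ≤ η) (hs : 0 ≤ s)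
    (hεs : ε * s ≤ η) (hn : 0 ≤ n) (hx : |x| ≤ E) :
    ε * (x * n + (1 - x * s)) ≤ η * (E * n + 1 + E) := by
  have hE := (abs_nonneg x).trans hx
  calc ε * (x * n + (1 - x * s)) = ε * (x * n + 1) + -x * (ε * s) := by ring
    _ ≤ ε * (E * n + 1) + E * (ε * s) := by
      gcongr
      · exact (le_abs_self x).trans hx
      · exact (neg_le_abs x).trans hx
    _ ≤ η * (E * n + 1) + E * η := by gcongr
    _ = η * (E * n + 1 + E) := by ring

lemma exists_bc_approx (hK : 0 < K) (ha : Antitone a) (haK : ∀ k, K ≤ k → a k = 0)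
    (hW : ∀ j, (W j).IsHermitian) (hne : (dualSlice W e).Nonempty) {c : ℝ} (hc : 0 < c)
    (hdual : ∀ y ∈ dualSlice W e, ∃ p ∈ powerSimplex K, c ≤ macWsr K h a (linCov W y) p) {τ : ℝ}
    (hτ : 0 < τ) :
    ∃ x ∈ bcFeasible K W (fun j => e j + τ),
      c ≤ ∑ i ∈ Finset.range K, a i * bcRate K h x.1 i := by
  obtain ⟨δ, hδ, hgrad⟩ := exists_forall_le_sum_macGrad K h ha hc
  set E := ∑ j, |e j|
  have : 0 ≤ E := Finset.sum_nonneg fun j _ => abs_nonneg _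
  have hEle : ∀ j, |e j| ≤ E := fun j =>
    Finset.single_le_sum (fun i _ => abs_nonneg (e i)) (Finset.mem_univ j)
  set η := τ * δ / (E * N + 1 + E)
  have hη_pos : 0 < η := by positivity
  obtain ⟨ε, hε, hεη, y, hy, p, hp, hsum, hsaddle⟩ :=
    exists_isSaddlePointOn_mul_sum_le (h := h) hK ha hne hη_pos
  obtain ⟨r, hr, hcr⟩ := hdual y hy
  have hcp : c ≤ macWsr K h a (linCov W y) p :=
    hcr.trans (le_of_add_le_add_right (hsaddle y hy r hr))
  have hκ := hgrad _ p hy.2.2 hp.1 hcp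
  set κ := ∑ k ∈ Finset.range K, p k * macGrad K h a (linCov W y) p k
  have hκ_pos : 0 < κ := hδ.trans_le hκ
  obtain ⟨x, ⟨hS, hzero, hSE, hpower⟩, hrate⟩ :=
    exists_bc_of_isSaddlePointOn ha haK hW hε.le hy hp hsaddle rfl hκ_pos
  refine ⟨x, ⟨hS, hzero, hSE, fun j => (hpower j).trans ?_⟩, hcp.trans hrate⟩
  have herror : ε * (e j * N + (1 - e j * ∑ i, y i)) ≤ τ * δ :=
    (mul_add_one_sub_mul_le hε.le hεη (Finset.sum_nonneg fun i _ => hy.1 i) hsum N.cast_nonneg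
      (hEle j)).trans_eq (div_mul_cancel₀ _ (by positivity))
  refine add_le_add_right ?_ (e j)
  rw [inv_mul_le_iff₀ hκ_pos, mul_comm κ]
  exact herror.trans (by gcongr)

end NearOptimal

/-! ### Compactness -/

lemma trace_conjTranspose_mul_self_re (C : Matrix (Fin N) (Fin N) ℂ) :
    (Cᴴ * C).trace.re = ∑ i, ∑ k, ‖C k i‖ ^ 2 := by
  simp only [Matrix.trace, Matrix.diag, Matrix.mul_apply, Matrix.conjTranspose_apply,
    Complex.re_sum, Complex.star_def, ← Complex.normSq_eq_conj_mul_self, Complex.ofReal_re,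
    Complex.normSq_eq_norm_sq]

lemma isCompact_posSemidef_trace_le (R : ℝ) :
    IsCompact {A : Matrix (Fin N) (Fin N) ℂ | A.PosSemidef ∧ A.trace.re ≤ R} := by
  have hbox : IsCompact (Set.univ.pi fun _ : Fin N => Set.univ.pi fun _ : Fin N =>
      Metric.closedBall (0 : ℂ) (√R)) :=
    isCompact_univ_pi fun _ => isCompact_univ_pi fun _ => isCompact_closedBall _ _
  have hfactor : IsCompact {C : Matrix (Fin N) (Fin N) ℂ | ∑ i, ∑ k, ‖C k i‖ ^ 2 ≤ R} := by
    refine IsCompact.of_isClosed_subset (X := Matrix (Fin N) (Fin N) ℂ) hbox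
      (isClosed_le (by fun_prop) continuous_const) fun C hC k _ i _ => ?_
    refine mem_closedBall_zero_iff.2 (Real.le_sqrt_of_sq_le (le_trans ?_ hC))
    exact (Finset.single_le_sum (f := fun k => ‖C k i‖ ^ 2) (fun _ _ => sq_nonneg _)
      (Finset.mem_univ k)).trans (Finset.single_le_sum (f := fun i => ∑ k, ‖C k i‖ ^ 2)
        (fun _ _ => Finset.sum_nonneg fun _ _ => sq_nonneg _) (Finset.mem_univ i))
  convert hfactor.image (f := fun C => Cᴴ * C) (by fun_prop) using 1
  ext A
  constructor
  · rintro ⟨hA, htrace⟩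
    obtain ⟨C, rfl⟩ := CStarAlgebra.nonneg_iff_eq_star_mul_self.1 hA.nonneg
    exact ⟨C, (trace_conjTranspose_mul_self_re C).symm.trans_le htrace, rfl⟩
  · rintro ⟨C, hC, rfl⟩
    exact ⟨Matrix.posSemidef_conjTranspose_mul_self C,
      (trace_conjTranspose_mul_self_re C).trans_le hC⟩

section BcFeasible

variable {K : ℕ} {h : ℕ → Fin N → ℂ} {a : ℕ → ℝ} {ι : Type*} {W : ι → Matrix (Fin N) (Fin N) ℂ}
  {e : ι → ℝ}

lemma isClosed_bcFeasible (K : ℕ) (W : ι → Matrix (Fin N) (Fin N) ℂ) (e : ι → ℝ) :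
    IsClosed (bcFeasible K W e) := by
  have hpower : ∀ j, Continuous fun x : (ℕ → Matrix (Fin N) (Fin N) ℂ) × Matrix (Fin N) (Fin N) ℂ =>
      trMul (∑ k ∈ Finset.range K, x.1 k + x.2) (W j) := fun j => by
    unfold trMul
    fun_prop
  simp only [bcFeasible, Set.ofPred_and, Set.ofPred_forall]
  refine (isClosed_iInter fun k => isClosed_posSemidef.preimage (by fun_prop)).inter
    ((isClosed_iInter fun k => isClosed_iInter fun _ =>
      isClosed_eq (by fun_prop) continuous_const).inter
    ((isClosed_posSemidef.preimage continuous_snd).inter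
      (isClosed_iInter fun j => isClosed_le (hpower j) continuous_const)))

lemma isCompact_bcFeasible {j : ι} (hj : W j = 1) : IsCompact (bcFeasible K W e) := by
  have hbox := isCompact_posSemidef_trace_le (N := N) (e j)
  refine ((isCompact_univ_pi fun _ : ℕ => hbox).prod hbox).of_isClosed_subset
    (isClosed_bcFeasible K W e) ?_
  rintro ⟨S, SE⟩ ⟨hS, hzero, hSE, hpower⟩
  have htrace_nonneg : ∀ {B : Matrix (Fin N) (Fin N) ℂ}, B.PosSemidef → 0 ≤ B.trace.re :=
    fun hB => (Complex.le_def.1 hB.trace_nonneg).1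
  have htrace : ∑ k ∈ Finset.range K, (S k).trace.re + SE.trace.re ≤ e j := by
    simpa [hj, trMul, Matrix.trace_sum] using hpower j
  have hsum_nonneg : 0 ≤ ∑ k ∈ Finset.range K, (S k).trace.re :=
    Finset.sum_nonneg fun k _ => htrace_nonneg (hS k)
  have hSE_nonneg := htrace_nonneg hSE
  refine ⟨fun k _ => ⟨hS k, ?_⟩, hSE, by linarith⟩
  by_cases hk : k < K
  · have hle := Finset.single_le_sum (fun k _ => htrace_nonneg (hS k)) (Finset.mem_range.2 hk)
    linarith
  · rw [hzero k (not_lt.1 hk), Matrix.trace_zero, Complex.zero_re]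
    linarith

lemma continuousOn_bcRate (K : ℕ) (h : ℕ → Fin N → ℂ) (i : ℕ) :
    ContinuousOn (fun S => bcRate K h S i) {S | ∀ k, (S k).PosSemidef} := by
  have hcont : ∀ m, Continuous fun S : ℕ → Matrix (Fin N) (Fin N) ℂ =>
      1 + quad (bcTail K S m) (h i) := fun m => by
    unfold quad bcTail
    fun_prop
  unfold bcRate
  exact ((hcont i).continuousOn.div (hcont (i + 1)).continuousOn
    fun S hS => (one_add_quad_bcTail_pos hS _ _).ne').log fun S hS =>
      (div_pos (one_add_quad_bcTail_pos hS _ _) (one_add_quad_bcTail_pos hS _ _)).ne'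

lemma isClosed_bcFeasible_le_sum_bcRate (K : ℕ) (h : ℕ → Fin N → ℂ) (a : ℕ → ℝ)
    (W : ι → Matrix (Fin N) (Fin N) ℂ) (e : ι → ℝ) (c : ℝ) :
    IsClosed {x ∈ bcFeasible K W e | c ≤ ∑ i ∈ Finset.range K, a i * bcRate K h x.1 i} := by
  have hcont : ContinuousOn (fun x => ∑ i ∈ Finset.range K, a i * bcRate K h x.1 i)
      (bcFeasible K W e) :=
    continuousOn_finsetSum _ fun i _ => continuousOn_const.mul
      ((continuousOn_bcRate K h i).comp continuousOn_fst fun x hx => hx.1)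
  exact hcont.preimage_isClosed_of_isClosed (isClosed_bcFeasible K W e) isClosed_Ici

lemma exists_mem_bcFeasible_of_forall_pos {j : ι} (hj : W j = 1) {c : ℝ}
    (happrox : ∀ τ > 0, ∃ x ∈ bcFeasible K W (fun j => e j + τ),
      c ≤ ∑ i ∈ Finset.range K, a i * bcRate K h x.1 i) :
    ∃ x ∈ bcFeasible K W e, c ≤ ∑ i ∈ Finset.range K, a i * bcRate K h x.1 i := by
  set t : ℕ → Set ((ℕ → Matrix (Fin N) (Fin N) ℂ) × Matrix (Fin N) (Fin N) ℂ) := fun n =>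
    {x ∈ bcFeasible K W (fun j => e j + 1 / ((n : ℝ) + 1)) |
      c ≤ ∑ i ∈ Finset.range K, a i * bcRate K h x.1 i}
  have hclosed : ∀ n, IsClosed (t n) := fun n => isClosed_bcFeasible_le_sum_bcRate K h a W _ c
  obtain ⟨x, hx⟩ := IsCompact.nonempty_iInter_of_sequence_nonempty_isCompact_isClosed t
    (fun n x hx => ⟨⟨hx.1.1, hx.1.2.1, hx.1.2.2.1, fun j => (hx.1.2.2.2 j).trans
      (add_le_add_right (Nat.one_div_le_one_div n.le_succ) _)⟩, hx.2⟩)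
    (fun n => happrox _ Nat.one_div_pos_of_nat)
    ((isCompact_bcFeasible hj).of_isClosed_subset (hclosed 0) fun x hx => hx.1) hclosed
  have hx := Set.mem_iInter.1 hx
  refine ⟨x, ⟨(hx 0).1.1, (hx 0).1.2.1, (hx 0).1.2.2.1, fun j => ?_⟩, (hx 0).2⟩
  have hlim : Filter.Tendsto (fun n : ℕ => e j + 1 / ((n : ℝ) + 1)) Filter.atTop (nhds (e j)) := by
    simpa using tendsto_const_nhds.add (tendsto_one_div_add_atTop_nhds_zero_nat (𝕜 := ℝ))
  exact ge_of_tendsto' hlim fun n => (hx n).1.2.2.2 j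

end BcFeasible

/-! ### Encoding orders -/

section Reordering

variable {K : ℕ} {h : ℕ → Fin N → ℂ} {S : ℕ → Matrix (Fin N) (Fin N) ℂ} {a q r : ℕ → ℝ}
  {A : Matrix (Fin N) (Fin N) ℂ}

lemma macCov_map (ρ : Equiv.Perm ℕ) (s : Finset ℕ) :
    macCov A h q (s.map ρ.toEmbedding) = macCov A (h ∘ ρ) (q ∘ ρ) s := by
  simp only [macCov, Finset.sum_map, Equiv.toEmbedding_apply, Function.comp_apply]

/-- The powers of `exists_mac_powers` serve all sets of users at once, so that the decoding order
`ρ` of the multiple access channel need not match the encoding order. -/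
lemma exists_sum_mul_bcRate_le_macWsr (ha : Antitone a) (haK : a K = 0) (hA : A.PosDef)
    (hS : ∀ k, (S k).PosSemidef) {ρ : Equiv.Perm ℕ} (hρ : ∀ k < K, ρ k < K) :
    ∃ q : ℕ → ℝ, 0 ≤ q ∧
      ∑ k ∈ Finset.range K, q k ≤ ∑ k ∈ Finset.range K, trMul A (S k) ∧
      ∑ i ∈ Finset.range K, a i * bcRate K h S (ρ i) ≤ macWsr K (h ∘ ρ) a A q := by
  obtain ⟨q, hq, hpower, hrate⟩ := exists_mac_powers (h := h) (K := K) hA hS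
  have hmap : ∀ m ≤ K, (Finset.range m).map ρ.toEmbedding ⊆ Finset.range K := by
    intro m hm k hk
    obtain ⟨i, hi, rfl⟩ := Finset.mem_map.1 hk
    exact Finset.mem_range.2 (hρ i ((Finset.mem_range.1 hi).trans_le hm))
  have hmap_range : (Finset.range K).map ρ.toEmbedding = Finset.range K :=
    Finset.eq_of_subset_of_card_le (hmap K le_rfl) (Finset.card_map _).ge
  refine ⟨q ∘ ρ, fun k => hq (ρ k), ?_, ?_⟩
  · rwa [← hmap_range, Finset.sum_map, hmap_range] at hpower
  · rw [sum_range_mul_eq_by_parts, haK, zero_mul, add_zero]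
    refine Finset.sum_le_sum fun i hi => mul_le_mul_of_nonneg_left ?_ (weight_sub_nonneg ha i)
    have hprefix := hrate _ (hmap (i + 1) (Finset.mem_range.1 hi))
    rwa [macCov_map, Finset.sum_map] at hprefix

lemma macWsr_congr (hqr : ∀ k < K, q k = r k) : macWsr K h a A q = macWsr K h a A r := by
  refine Finset.sum_congr rfl fun i hi => ?_
  rw [macCov, macCov, Finset.sum_congr rfl fun k hk => ?_]
  rw [hqr k (by grind)]

lemma exists_mem_powerSimplex_macWsr_le (hK : 0 < K) (ha : Antitone a) (hA : A.PosDef)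
    (hq : 0 ≤ q) (hsum : ∑ k ∈ Finset.range K, q k ≤ 1) :
    ∃ p ∈ powerSimplex K, macWsr K h a A q ≤ macWsr K h a A p := by
  have hext : ∀ k < K, q k = (Set.Iio K).indicator q k := fun k hk =>
    (Set.indicator_of_mem (Set.mem_Iio.2 hk) q).symm
  have hext_nonneg : 0 ≤ (Set.Iio K).indicator q := Set.indicator_nonneg fun k _ => hq k
  have hrest : 0 ≤ (1 - ∑ k ∈ Finset.range K, q k) • (Pi.single 0 1 : ℕ → ℝ) :=
    smul_nonneg (sub_nonneg.2 hsum) (Pi.single_nonneg.2 zero_le_one)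
  refine ⟨(Set.Iio K).indicator q + (1 - ∑ k ∈ Finset.range K, q k) • Pi.single 0 1,
    ⟨add_nonneg hext_nonneg hrest, fun k hk => ?_, ?_⟩, ?_⟩
  · simp [hk, (hK.trans_le hk).ne']
  · simp only [Pi.add_apply, Finset.sum_add_distrib, Pi.smul_apply, ← Finset.smul_sum,
      (single_mem_powerSimplex hK).2.2,
      ← Finset.sum_congr rfl fun k hk => hext k (Finset.mem_range.1 hk)]
    simp
  · rw [macWsr_congr hext]
    exact macWsr_mono ha hA hext_nonneg (le_add_of_nonneg_right hrest)

end Reordering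

/-- The extension by zero of a family indexed by `Fin K` to a sequence. -/
def zeroExtend {K : ℕ} {β : Type*} [Zero β] (f : Fin K → β) : ℕ → β :=
  Function.extend Fin.val f 0

section ZeroExtend

variable {K : ℕ} {β : Type*} [Zero β]

lemma zeroExtend_val (f : Fin K → β) (i : Fin K) : zeroExtend f i = f i :=
  Fin.val_injective.extend_apply f 0 i

lemma zeroExtend_of_le (f : Fin K → β) {k : ℕ} (hk : K ≤ k) : zeroExtend f k = 0 :=
  Function.extend_apply' _ _ _ (by rintro ⟨i, rfl⟩; exact i.2.not_ge hk)

lemma zeroExtend_prop (f : Fin K → β) {P : β → Prop} (h0 : P 0) (hf : ∀ i, P (f i)) (k : ℕ) :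
    P (zeroExtend f k) := by
  by_cases hk : k < K
  · exact zeroExtend_val f ⟨k, hk⟩ ▸ hf ⟨k, hk⟩
  · exact zeroExtend_of_le f (not_lt.1 hk) ▸ h0

lemma zeroExtend_comp_viaEmbedding (f : Fin K → β) (π : Equiv.Perm (Fin K)) :
    zeroExtend f ∘ π.viaEmbedding Fin.valEmbedding = zeroExtend (f ∘ π) := by
  ext k
  by_cases hk : k < K
  · have hval := π.viaEmbedding_apply Fin.valEmbedding ⟨k, hk⟩
    simp only [Fin.valEmbedding_apply] at hval
    rw [Function.comp_apply, hval, zeroExtend_val]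
    exact (zeroExtend_val (f ∘ π) ⟨k, hk⟩).symm
  · have hval := π.viaEmbedding_apply_of_notMem Fin.valEmbedding k (by
      rintro ⟨i, rfl⟩
      exact hk i.2)
    rw [Function.comp_apply, hval, zeroExtend_of_le _ (not_lt.1 hk),
      zeroExtend_of_le _ (not_lt.1 hk)]

end ZeroExtend

/-- The channel vectors in the encoding order `π`, normalised to unit noise. -/
def orderedChannel (M : SwiptBC N KI KE) (π : Equiv.Perm (Fin KI)) : ℕ → Fin N → ℂ :=
  zeroExtend fun i => M.σ⁻¹ • M.h (π i)

/-- An encoding order by decreasing rate weight. -/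
def sortPerm (M : SwiptBC N KI KE) : Equiv.Perm (Fin KI) :=
  Tuple.sort fun i => -M.α i

/-- The decreasing rate weights, rescaled from bits to nats. -/
def sortedWeight (M : SwiptBC N KI KE) : ℕ → ℝ :=
  zeroExtend fun i => M.α (M.sortPerm i) / Real.log 2

section Users

variable {M : SwiptBC N KI KE} {S : Fin KI → Matrix (Fin N) (Fin N) ℂ}
  {T : ℕ → Matrix (Fin N) (Fin N) ℂ} {π : Equiv.Perm (Fin KI)}

lemma antitone_sortedWeight (hα : ∀ i, 0 ≤ M.α i) : Antitone M.sortedWeight := by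
  have hlog : 0 ≤ Real.log 2 := (Real.log_pos one_lt_two).le
  intro i j hij
  by_cases hj : j < KI
  · have hsort := Tuple.monotone_sort (fun i => -M.α i)
      (show (⟨i, hij.trans_lt hj⟩ : Fin KI) ≤ ⟨j, hj⟩ from hij)
    have hi := zeroExtend_val (fun i => M.α (M.sortPerm i) / Real.log 2) ⟨i, hij.trans_lt hj⟩
    have hj := zeroExtend_val (fun i => M.α (M.sortPerm i) / Real.log 2) ⟨j, hj⟩
    rw [sortedWeight, hi, hj]
    exact div_le_div_of_nonneg_right (neg_le_neg_iff.1 hsort) hlog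
  · rw [sortedWeight, zeroExtend_of_le _ (not_lt.1 hj)]
    exact zeroExtend_prop _ le_rfl (fun i => div_nonneg (hα _) hlog) i

lemma quad_real_smul (B : Matrix (Fin N) (Fin N) ℂ) (t : ℝ) (v : Fin N → ℂ) :
    quad B (t • v) = t ^ 2 * quad B v := by
  simp only [quad, Matrix.mulVec_smul, star_smul, star_trivial, smul_dotProduct, dotProduct_smul,
    smul_smul, Complex.smul_re, smul_eq_mul, pow_two]

lemma bcTail_eq_sum_Ici (hT : ∀ i : Fin KI, T i = S (π i)) (i : Fin KI) :
    bcTail KI T i = ∑ k ∈ Finset.Ici i, S (π k) := by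
  rw [bcTail, ← Fin.map_valEmbedding_Ici, Finset.sum_map]
  exact Finset.sum_congr rfl fun k _ => hT k

lemma bcTail_succ_eq_sum_Ioi (hT : ∀ i : Fin KI, T i = S (π i)) (i : Fin KI) :
    bcTail KI T (i + 1) = ∑ k ∈ Finset.Ioi i, S (π k) := by
  rw [bcTail, Finset.Ico_add_one_left_eq_Ioo, ← Fin.map_valEmbedding_Ioi, Finset.sum_map]
  exact Finset.sum_congr rfl fun k _ => hT k

lemma bcRate_eq_log_mul_dpcRate (hσ : 0 < M.σ) (hT : ∀ i : Fin KI, T i = S (π i)) (i : Fin KI) :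
    bcRate KI (M.orderedChannel π) T i = Real.log 2 * M.dpcRate S π i := by
  have hscale : ∀ B, 1 + quad B (M.σ⁻¹ • M.h (π i)) =
      (M.σ ^ 2)⁻¹ * (M.σ ^ 2 + quad B (M.h (π i))) := fun B => by
    rw [quad_real_smul]
    field_simp
  rw [bcRate, orderedChannel, zeroExtend_val, hscale, hscale,
    mul_div_mul_left _ _ (by positivity), bcTail_eq_sum_Ici hT, bcTail_succ_eq_sum_Ioi hT, dpcRate,
    Real.logb, mul_div_cancel₀ _ (Real.log_pos one_lt_two).ne']

lemma dpcRate_nonneg (hσ : 0 < M.σ) (hS : ∀ i, (S i).PosSemidef) (i : Fin KI) :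
    0 ≤ M.dpcRate S π i := by
  have hinterference := quad_nonneg (Matrix.posSemidef_sum (Finset.Ioi i) fun k _ => hS (π k))
    (M.h (π i))
  have hle : ∑ k ∈ Finset.Ioi i, S (π k) ≤ ∑ k ∈ Finset.Ici i, S (π k) :=
    Finset.sum_le_sum_of_subset_of_nonneg Finset.Ioi_subset_Ici_self fun k _ _ => (hS (π k)).nonneg
  refine Real.logb_nonneg one_lt_two ((one_le_div (by positivity)).2 ?_)
  exact add_le_add_right (quad_mono hle _) _

lemma wsr_nonneg (hα : ∀ i, 0 ≤ M.α i) {x : Point N KI} (hx : M.Admissible x) : 0 ≤ M.wsr x.r := by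
  obtain ⟨π, hr, -⟩ := Set.mem_iUnion.1 hx.1
  exact Finset.sum_nonneg fun i _ => mul_nonneg (hα i) (hr i)

/-- The permutation of the indices leading from the encoding order `π` to the order by decreasing
rate weight. -/
def reindexing (M : SwiptBC N KI KE) (π : Equiv.Perm (Fin KI)) : Equiv.Perm ℕ :=
  Equiv.Perm.viaEmbedding (M.sortPerm.trans π.symm) Fin.valEmbedding

lemma reindexing_val (i : Fin KI) : M.reindexing π i = π.symm (M.sortPerm i) :=
  Equiv.Perm.viaEmbedding_apply _ Fin.valEmbedding i

lemma orderedChannel_comp_reindexing :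
    M.orderedChannel π ∘ M.reindexing π = M.orderedChannel M.sortPerm := by
  rw [orderedChannel, reindexing, zeroExtend_comp_viaEmbedding, orderedChannel]
  congr 1
  ext i : 1
  simp

lemma wsr_le_sum_sortedWeight_mul_bcRate (hσ : 0 < M.σ) (hα : ∀ i, 0 ≤ M.α i) {r : Fin KI → ℝ}
    (hr : ∀ i, r (π i) ≤ M.dpcRate S π i) (hT : ∀ i : Fin KI, T i = S (π i)) :
    M.wsr r ≤ ∑ i ∈ Finset.range KI,
      M.sortedWeight i * bcRate KI (M.orderedChannel π) T (M.reindexing π i) := by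
  rw [Finset.sum_range, wsr, ← Equiv.sum_comp M.sortPerm]
  refine Finset.sum_le_sum fun i _ => ?_
  have hlog := Real.log_pos one_lt_two
  rw [sortedWeight, zeroExtend_val, reindexing_val, bcRate_eq_log_mul_dpcRate hσ hT,
    ← mul_assoc, div_mul_cancel₀ _ hlog.ne']
  refine mul_le_mul_of_nonneg_left ?_ (hα _)
  simpa using hr (π.symm (M.sortPerm i))

lemma wsr_dpcRate_sortPerm (hσ : 0 < M.σ) (hT : ∀ i : Fin KI, T i = S (M.sortPerm i)) :
    M.wsr (fun u => M.dpcRate S M.sortPerm (M.sortPerm.symm u)) = ∑ i ∈ Finset.range KI,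
      M.sortedWeight i * bcRate KI (M.orderedChannel M.sortPerm) T i := by
  have hlog := Real.log_pos one_lt_two
  rw [Finset.sum_range, wsr,
    ← Equiv.sum_comp M.sortPerm fun u => M.α u * M.dpcRate S M.sortPerm (M.sortPerm.symm u)]
  refine Finset.sum_congr rfl fun i _ => ?_
  rw [Equiv.symm_apply_apply, sortedWeight, zeroExtend_val, bcRate_eq_log_mul_dpcRate hσ hT,
    ← mul_assoc, div_mul_cancel₀ _ hlog.ne']

lemma exists_mem_powerSimplex_wsr_le (hKI : 1 ≤ KI) (hσ : 0 < M.σ) (hα : ∀ i, 0 ≤ M.α i)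
    {x : Point N KI} (hx : M.Admissible x) {A : Matrix (Fin N) (Fin N) ℂ} (hA : A.PosDef)
    (hbudget : ∑ i, trMul A (x.S i) + trMul A x.SE ≤ 1) :
    ∃ p ∈ powerSimplex KI,
      M.wsr x.r ≤ macWsr KI (M.orderedChannel M.sortPerm) M.sortedWeight A p := by
  obtain ⟨hr, hSE, hS⟩ := hx
  obtain ⟨π, -, hrate⟩ := Set.mem_iUnion.1 hr
  set T : ℕ → Matrix (Fin N) (Fin N) ℂ := zeroExtend (x.S ∘ π) with hT
  have hpower_eq : ∑ k ∈ Finset.range KI, trMul A (T k) = ∑ i, trMul A (x.S i) := by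
    rw [Finset.sum_range, ← Equiv.sum_comp π fun i => trMul A (x.S i)]
    simp only [hT, zeroExtend_val, Function.comp_apply]
  have ha := antitone_sortedWeight hα
  obtain ⟨q, hq, hpower, hwsr⟩ := exists_sum_mul_bcRate_le_macWsr (h := M.orderedChannel π)
    (ρ := M.reindexing π) ha (zeroExtend_of_le _ le_rfl) hA
    (zeroExtend_prop (x.S ∘ π) Matrix.PosSemidef.zero fun i => hS (π i))
    fun k hk => (reindexing_val (M := M) ⟨k, hk⟩).trans_lt (Fin.is_lt _)
  have hsum : ∑ k ∈ Finset.range KI, q k ≤ 1 := by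
    have hSE_nonneg := trMul_nonneg hA.posSemidef hSE
    linarith
  obtain ⟨p, hp, hqp⟩ := exists_mem_powerSimplex_macWsr_le hKI ha hA hq hsum
  refine ⟨p, hp, (wsr_le_sum_sortedWeight_mul_bcRate hσ hα hrate (zeroExtend_val _)).trans
    (hwsr.trans ?_)⟩
  rwa [orderedChannel_comp_reindexing]

end Users

/-! ### Strong duality -/

/-- The matrices of the linear constraints: the total power and the negated harvested powers. -/
def constrMatrix (M : SwiptBC N KI KE) : Option (Fin KE) → Matrix (Fin N) (Fin N) ℂ
  | none => 1
  | some j => -M.G j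

/-- The right-hand sides of the linear constraints. -/
def constrBound (M : SwiptBC N KI KE) : Option (Fin KE) → ℝ
  | none => M.Psum
  | some j => -M.E j

section Duality

variable {M : SwiptBC N KI KE}

lemma isHermitian_constrMatrix : ∀ j, (M.constrMatrix j).IsHermitian
  | none => Matrix.isHermitian_one
  | some j => (posSemidef_outer (M.g j)).isHermitian.neg

lemma combA_eq_linCov (y : Option (Fin KE) → ℝ) :
    M.combA (y none) (fun j => y (some j)) = linCov M.constrMatrix y := by
  simp only [linCov_apply, Fintype.sum_option, combA, constrMatrix, smul_neg,
    Finset.sum_neg_distrib, Complex.coe_smul, sub_eq_add_neg]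

lemma combP_eq_sum (y : Option (Fin KE) → ℝ) :
    M.combP (y none) (fun j => y (some j)) = ∑ j, y j * M.constrBound j := by
  simp only [Fintype.sum_option, combP, constrBound, mul_neg, Finset.sum_neg_distrib,
    sub_eq_add_neg]

lemma trMul_constrMatrix_le_iff (Q : Matrix (Fin N) (Fin N) ℂ) :
    (∀ j, trMul Q (M.constrMatrix j) ≤ M.constrBound j) ↔
      (∀ j, M.E j ≤ trMul Q (M.G j)) ∧ Q.trace.re ≤ M.Psum := by
  rw [Option.forall, and_comm]
  simp only [constrMatrix, constrBound, trMul, mul_one, Matrix.mul_neg, Matrix.trace_neg,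
    Complex.neg_re, neg_le_neg_iff]

lemma optP1_le_optP2 (M : SwiptBC N KI KE) : M.optP1 ≤ M.optP2 := by
  refine le_sInf ?_
  rintro _ ⟨l0, l, hl0, hl, rfl⟩
  refine sSup_le_sSup ?_
  rintro _ ⟨x, ⟨hadm, hconstr⟩, rfl⟩
  refine ⟨x, ⟨hadm, ?_⟩, rfl⟩
  set y : Option (Fin KE) → ℝ := fun j => j.elim l0 l
  have hy : ∀ j, 0 ≤ y j := Option.forall.2 ⟨hl0, hl⟩
  calc ∑ i, trMul (M.combA l0 l) (x.S i) + trMul (M.combA l0 l) x.SE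
      = ∑ j, y j * trMul (∑ i, x.S i + x.SE) (M.constrMatrix j) := by
        rw [← trMul_sum, ← trMul_add, trMul_comm,
          show M.combA l0 l = linCov M.constrMatrix y from combA_eq_linCov y, linCov_apply,
          trMul_sum]
        simp only [trMul_smul]
    _ ≤ ∑ j, y j * M.constrBound j := Finset.sum_le_sum fun j _ =>
        mul_le_mul_of_nonneg_left ((trMul_constrMatrix_le_iff _).2 hconstr j) (hy j)
    _ = M.combP l0 l := (combP_eq_sum y).symm

lemma nonempty_dualSlice_constrMatrix (hP : 0 < M.Psum) :
    (dualSlice M.constrMatrix M.constrBound).Nonempty := by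
  refine ⟨M.Psum⁻¹ • Pi.single none 1, smul_nonneg (inv_nonneg.2 hP.le)
    (Pi.single_nonneg.2 zero_le_one), ?_, ?_⟩
  · simp [Fintype.sum_option, constrBound, hP.ne']
  · rw [map_smul, linCov_single]
    exact Matrix.PosDef.one.smul (inv_pos.2 hP)

lemma exists_le_macWsr_of_lt_optP2 (hKI : 1 ≤ KI) (hσ : 0 < M.σ) (hα : ∀ i, 0 ≤ M.α i) {c : ℝ}
    (hc : (c : EReal) < M.optP2) {y : Option (Fin KE) → ℝ}
    (hy : y ∈ dualSlice M.constrMatrix M.constrBound) :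
    ∃ p ∈ powerSimplex KI, c ≤ macWsr KI (M.orderedChannel M.sortPerm) M.sortedWeight
      (linCov M.constrMatrix y) p := by
  have hlt : (c : EReal) < M.gAux (y none) fun j => y (some j) :=
    hc.trans_le (sInf_le ⟨_, _, hy.1 none, fun j => hy.1 (some j), rfl⟩)
  obtain ⟨_, ⟨x, ⟨hadm, hbudget⟩, rfl⟩, hcx⟩ := lt_sSup_iff.1 hlt
  rw [combA_eq_linCov, combP_eq_sum, hy.2.1] at hbudget
  obtain ⟨p, hp, hle⟩ := exists_mem_powerSimplex_wsr_le hKI hσ hα hadm hy.2.2 hbudget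
  exact ⟨p, hp, (EReal.coe_lt_coe_iff.1 hcx).le.trans hle⟩

lemma exists_feasibleP1_of_mem_bcFeasible (hσ : 0 < M.σ)
    {z : (ℕ → Matrix (Fin N) (Fin N) ℂ) × Matrix (Fin N) (Fin N) ℂ}
    (hz : z ∈ bcFeasible KI M.constrMatrix M.constrBound) :
    ∃ x : Point N KI, M.FeasibleP1 x ∧ M.wsr x.r = ∑ i ∈ Finset.range KI,
      M.sortedWeight i * bcRate KI (M.orderedChannel M.sortPerm) z.1 i := by
  obtain ⟨hS, -, hSE, hconstr⟩ := hz
  set S : Fin KI → Matrix (Fin N) (Fin N) ℂ := fun u => z.1 (M.sortPerm.symm u) with hS_def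
  have hsum : ∑ u, S u = ∑ k ∈ Finset.range KI, z.1 k := by
    rw [Finset.sum_range, ← Equiv.sum_comp M.sortPerm.symm fun i : Fin KI => z.1 i]
  have hregion : (fun u => M.dpcRate S M.sortPerm (M.sortPerm.symm u)) ∈ M.rateRegion S :=
    Set.mem_iUnion.2 ⟨M.sortPerm, fun u => dpcRate_nonneg hσ (fun _ => hS _) _,
      fun i => (congrArg _ (M.sortPerm.symm_apply_apply i)).le⟩
  rw [← hsum, trMul_constrMatrix_le_iff] at hconstr
  refine ⟨⟨S, _, z.2⟩, ⟨⟨hregion, hSE, fun _ => hS _⟩, hconstr⟩,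
    wsr_dpcRate_sortPerm hσ fun i => ?_⟩
  simp only [hS_def, Equiv.symm_apply_apply]

lemma exists_feasibleP1_of_lt_optP2 (hKI : 1 ≤ KI) (hσ : 0 < M.σ) (hα : ∀ i, 0 ≤ M.α i)
    (hP : 0 < M.Psum) {c : ℝ} (hc : 0 < c) (hlt : (c : EReal) < M.optP2) :
    ∃ x : Point N KI, M.FeasibleP1 x ∧ c ≤ M.wsr x.r := by
  obtain ⟨z, hz, hcz⟩ := exists_mem_bcFeasible_of_forall_pos (W := M.constrMatrix) (j := none) rfl
    fun τ hτ => exists_bc_approx hKI (antitone_sortedWeight hα) (fun _ => zeroExtend_of_le _)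
      isHermitian_constrMatrix (nonempty_dualSlice_constrMatrix hP) hc
      (fun y hy => exists_le_macWsr_of_lt_optP2 hKI hσ hα hlt hy) hτ
  obtain ⟨x, hx, hwsr⟩ := exists_feasibleP1_of_mem_bcFeasible hσ hz
  exact ⟨x, hx, hcz.trans_eq hwsr.symm⟩

lemma optP2_le_optP1 (hKI : 1 ≤ KI) (hσ : 0 < M.σ) (hα : ∀ i, 0 ≤ M.α i) (hP : 0 < M.Psum)
    (hfeas : ∃ x : Point N KI, M.FeasibleP1 x) : M.optP2 ≤ M.optP1 := by
  refine EReal.ge_of_forall_gt_iff_ge.1 fun c hlt => ?_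
  rcases lt_or_ge 0 c with hc | hc
  · obtain ⟨x, hx, hcx⟩ := exists_feasibleP1_of_lt_optP2 hKI hσ hα hP hc hlt
    exact (EReal.coe_le_coe_iff.2 hcx).trans (le_sSup ⟨x, hx, rfl⟩)
  · obtain ⟨x, hx⟩ := hfeas
    exact (EReal.coe_le_coe_iff.2 (hc.trans (wsr_nonneg hα hx.1))).trans (le_sSup ⟨x, hx, rfl⟩)

end Duality

end SwiptBC

end

theorem lemma3p4 {N KI KE : ℕ} (hN : 1 < N) (hKI : 1 ≤ KI) (hKE : 1 ≤ KE)
    (M : SwiptBC N KI KE) (hσ : 0 < M.σ) (hα : ∀ i, 0 < M.α i) (hP : 0 < M.Psum)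
    (hE : ∀ j, 0 < M.E j) (hfeas : ∃ x : SwiptBC.Point N KI, M.FeasibleP1 x) :
    M.optP1 = M.optP2 :=
  le_antisymm (SwiptBC.optP1_le_optP2 M)
    (SwiptBC.optP2_le_optP1 hKI hσ (fun i => (hα i).le) hP hfeas)
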